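/- **Model.** Consider a discrete-time load balancing system with $N\ge 1$ parallel servers operating under Join the Shortest Queue. In each time slot a number $a(k)\in\mathbb Z_{\ge0}$ of jobs arrives, all of them are routed to one of the shortest queues (ties are broken uniformly at random), and then server $i$ offers a potential service $s_i(k)\in\mathbb Z_{\ge0}$, so that $q_i(k+1)=\max\{q_i(k)+a_i(k)-s_i(k),0\}$, where $a_i(k)=a(k)$ if $i$ is the chosen queue and $a_i(k)=0$ otherwise. The $a(k)$ are i.i.d. in $k$, the vectors $(s_1(k),\dots,s_N(k))$ are i.i.d. in $k$ with independent coordinates, and arrivals, services and routing choices are independent of each other and of the past. Assume $a(1)\le a_{\max}$ and $s_i(1)\le s_{\max}$ almost surely, with finite $a_{\max},s_{\max}$; $\mathbb E[a(1)]=N(1-N^{-\alpha})$, $\operatorname{Var}(a(1))=N\sigma_a^2$; $\mathbb E[s_i(1)]=1$ and $\operatorname{Var}(s_i(1))=\sigma_s^2$ for every $i$; $\sigma_a^2+\sigma_s^2>0$; and $\alpha>1$. Let $\bar q=(\bar q_1,\dots,\bar q_N)$ be a steady-state vector of queue lengths, i.e. a limit in distribution of $q(k)$ as $k\to\infty$,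 and let $\bar q_\perp=\bar q-\big(\tfrac1N\sum_{i}\bar q_i\big)\mathbf 1$. Let $Z$ be exponential with mean $1$. For real random variables $X,Y$ let $d_W(X,Y)=\sup_h|\mathbb E\,h(X)-\mathbb E\,h(Y)|$, the supremum being over all $1$-Lipschitz $h:\mathbb R\to\mathbb R$; $\|\cdot\|$ is the Euclidean norm and $\log$ the natural logarithm. **Theorem.** For all $M$ and all $\delta\in(0,1)$ there is a finite constant $C$, depending only on $M$ and $\delta$, such that for every system as above with $\max\{a_{\max},s_{\max}\}\le M$ and $\delta\le 1-N^{-\alpha}$ the following hold. (i) (State space collapse.) $\mathbb E\|\bar q_\perp\|^r\le C^r r^{r+1/2}e^{1-r}N^r$ for all $r=1,2,\dots$. (ii) $\sum_i\bar q_i$ is integrable and, with the same $C$ and $\overline C=C\,s_{\max}\,e^{\frac1{2e}+1}$, $$d_W\Big(\frac{2N^{-\alpha}}{\sigma_a^2+\sigma_s^2}\sum_{i=1}^N\bar q_i,\;Z\Big)\le\frac1{\sigma_a^2+\sigma_s^2}\Big(5s_{\max}N^{1-\alpha}+N^{1-2\alpha}+2\,\overline C\,\lceil\alpha-1\rceil\,N^{2-\alpha}\,\lceil\log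 N\rceil\Big).$$ Moreover, for fixed constants $\alpha>2$, $\sigma_a,\sigma_s,s_{\max},C$, the right-hand side in (ii) tends to $0$ as $N\to\infty$. -/

import Mathlib

open MeasureTheory ProbabilityTheory Filter Topology
open scoped ENNReal

noncomputable section

/-- The Wasserstein distance between two measures on the real line: the supremum of
`|∫ h dν₁ - ∫ h dν₂|` over all `1`-Lipschitz functions `h : ℝ → ℝ`. It is the usual distance for
probability measures with a finite first moment (otherwise the integrals are junk values). -/
def wassersteinDist (ν₁ ν₂ : Measure ℝ) : ℝ≥0∞ :=
  ⨆ (h : ℝ → ℝ) (_ : LipschitzWith 1 h), ENNReal.ofReal |∫ x, h x ∂ν₁ - ∫ x, h x ∂ν₂|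

/-- The data of a discrete-time load balancing system with `N` parallel servers: the law of the
number `a(k)` of arrivals in a time slot, and for each server `i` the law of the potential service
`s_i(k)` in a time slot. -/
structure LoadBalancingSystem (N : ℕ) where
  arrival : PMF ℕ
  service : Fin N → PMF ℕ

namespace LoadBalancingSystem

variable {N : ℕ}

/-- The indices of the shortest queues. -/
def shortestQueues (q : Fin N → ℕ) : Finset (Fin N) :=
  Finset.univ.filter fun i => ∀ j, q i ≤ q j

theorem shortestQueues_nonempty [NeZero N] (q : Fin N → ℕ) : (shortestQueues q).Nonempty := by
  obtain ⟨i, -, hi⟩ := Finset.exists_min_image Finset.univ q ⟨(0 : Fin N), Finset.mem_univ _⟩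
  exact ⟨i, by simpa [shortestQueues] using fun j => hi j (Finset.mem_univ j)⟩

/-- The joint law of the potential services `(s_1, …, s_N)` of one time slot: the services of
different servers are independent. -/
def serviceVector (S : LoadBalancingSystem N) : PMF (Fin N → ℕ) :=
  (Measure.pi fun i => (S.service i).toMeasure).toPMF

/-- The queue lengths after one time slot, if `n` jobs arrive and are all sent to queue `i`, and the
potential services are `s`: `q_j⁺ = max {q_j + a_j - s_j, 0}` (subtraction of natural numbers is
truncated at `0`), where `a_i = n` and `a_j = 0` for `j ≠ i`. -/
def nextQueues (q : Fin N → ℕ) (i : Fin N) (n : ℕ) (s : Fin N → ℕ) : Fin N → ℕ :=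
  fun j => (q j + if j = i then n else 0) - s j

/-- One time slot under Join the Shortest Queue: the transition law of the queue length chain from
the state `q`. The queue is chosen uniformly at random among the shortest ones; the number of
arrivals and the potential services are independent of it, of each other and of the past. -/
def jsqStep [NeZero N] (S : LoadBalancingSystem N) (q : Fin N → ℕ) : PMF (Fin N → ℕ) :=
  (PMF.uniformOfFinset (shortestQueues q) (shortestQueues_nonempty q)).bind fun i =>
    S.arrival.bind fun n =>
      S.serviceVector.bind fun s => PMF.pure (nextQueues q i n s)

/-- The law of the vector of queue lengths after `k` time slots under Join the Shortest Queue, if the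
initial vector of queue lengths has law `μ₀`. -/
def queueLaw [NeZero N] (S : LoadBalancingSystem N) (μ₀ : PMF (Fin N → ℕ)) : ℕ → PMF (Fin N → ℕ)
  | 0 => μ₀
  | k + 1 => (queueLaw S μ₀ k).bind S.jsqStep

/-- A law on queue length vectors, as an element of the space of probability measures with the
topology of convergence in distribution. -/
def toProbabilityMeasure (μ : PMF (Fin N → ℕ)) : ProbabilityMeasure (Fin N → ℕ) :=
  ⟨μ.toMeasure, inferInstance⟩

/-- `π` is the law of a steady-state vector of queue lengths: the limit in distribution of the queue
length chain `q(k)` as `k → ∞`, from some initial distribution. -/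
def IsSteadyState [NeZero N] (S : LoadBalancingSystem N) (π : PMF (Fin N → ℕ)) : Prop :=
  ∃ μ₀ : PMF (Fin N → ℕ),
    Tendsto (fun k => toProbabilityMeasure (S.queueLaw μ₀ k)) atTop (𝓝 (toProbabilityMeasure π))

/-- The assumptions on the primitives of the system with `N` servers: bounded arrivals with mean
`N (1 - N^{-α})` and variance `N σ_a²`, and bounded potential services with mean `1` and variance
`σ_s²` at each server. -/
structure IsParametrized (S : LoadBalancingSystem N) (α σa σs amax smax : ℝ) : Prop where
  arrival_le : ∀ n ∈ S.arrival.support, (n : ℝ) ≤ amax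
  service_le : ∀ i, ∀ n ∈ (S.service i).support, (n : ℝ) ≤ smax
  arrival_mean : ∫ n, (n : ℝ) ∂S.arrival.toMeasure = N * (1 - (N : ℝ) ^ (-α))
  arrival_var : variance (fun n : ℕ => (n : ℝ)) S.arrival.toMeasure = N * σa ^ 2
  service_mean : ∀ i, ∫ n, (n : ℝ) ∂(S.service i).toMeasure = 1
  service_var : ∀ i, variance (fun n : ℕ => (n : ℝ)) (S.service i).toMeasure = σs ^ 2

/-- The vector `q_⊥ = q - q_∥`, where every coordinate of `q_∥` is the average of the `q_i`. -/
def perp (q : Fin N → ℕ) : EuclideanSpace ℝ (Fin N) :=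
  WithLp.toLp 2 fun i => (q i : ℝ) - (∑ j, (q j : ℝ)) / N

/-- State space collapse with constant `C`: for all `r = 1, 2, …` we have
`E ‖q_⊥‖ ^ r ≤ K(r) N ^ r`, where `K(r) = C ^ r r ^ (r + 1/2) e ^ (1 - r)`. -/
def StateSpaceCollapse (π : PMF (Fin N → ℕ)) (C : ℝ) : Prop :=
  ∀ r : ℕ, 1 ≤ r →
    Integrable (fun q => ‖perp q‖ ^ r) π.toMeasure ∧
    ∫ q, ‖perp q‖ ^ r ∂π.toMeasure ≤
      C ^ r * (r : ℝ) ^ ((r : ℝ) + 1 / 2) * Real.exp (1 - r) * (N : ℝ) ^ r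

/-- The scaled total queue length `2 N^{-α} / (σ_a² + σ_s²) * ∑ i, q_i`. -/
def scaledTotal (α σa σs : ℝ) (q : Fin N → ℕ) : ℝ :=
  2 * (N : ℝ) ^ (-α) / (σa ^ 2 + σs ^ 2) * ∑ i, (q i : ℝ)

/-- The bound on the Wasserstein distance, with `C̄ = C s_max e ^ (1 / (2 e) + 1)`. -/
def wassersteinBound (N : ℕ) (α σa σs smax C : ℝ) : ℝ :=
  1 / (σa ^ 2 + σs ^ 2) *
    (5 * smax * (N : ℝ) ^ (1 - α) + (N : ℝ) ^ (1 - 2 * α) +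
      2 * (C * smax * Real.exp (1 / (2 * Real.exp 1) + 1)) * (⌈α - 1⌉ : ℝ) *
        (N : ℝ) ^ (2 - α) * (⌈Real.log N⌉ : ℝ))

end LoadBalancingSystem

end

/-! The uniformity in `N` is cheap. The mean arrival number `N (1 - N^{-α})` is at most `M` and the
load is at least `δ`, so `N ≤ M / δ`, and a constant depending on `M` and `δ` may absorb any fixed
power of `N`. What has to be proved is an exponential moment for the imbalance of the queues and an
exponential approximation with error of order `N^{-α}`, up to a factor of order `α log N`.

State space collapse. A limit in distribution of the chain is stationary
(`IsSteadyState.bind_jsqStep`). Let `m` be the average queue and `F = ∑ exp (θ (m - q_j))`, which is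
`expSpread`. Reflection at zero does not increase `F` (`expSpread_max_zero_le`). Services cancel in
its first-order drift, while arrivals enter the shortest queue, where the weight is largest. This
gives a contraction rate of order `θ δ / N`, which does not degenerate as the load tends to one. For
small `θ` it beats the second-order term, so `E F ≤ 2N` in steady state
(`lintegral_le_of_geometric_drift`, `expSpread_moment`). Since `F` controls `exp (θ ‖q_⊥‖ / (2N))`,
all moments follow, with `r!` bounded by Stirling's formula.

Exponential limit. Stein's method is applied to the scaled total queue length. The Stein solution
`g` for a Lipschitz test function `f` vanishes at `0`, is 1-Lipschitz and has a 2-Lipschitz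
derivative. Comparing the primitive of `g` before and after one slot in steady state leaves exactly
the drift times `E f(X) - E f(Z)`, up to remainders. The critical remainder is the expectation of
unused service times the next total queue length. Unused service leaves some queue empty, and then
`F ≥ exp (θ m)`, so the total is at most logarithmic outside an event that `F` controls
(`unused_mul_total_le`). As unused service has mean `N · N^{-α}`, this remainder is small. -/

noncomputable section

/-! ### Foster's criterion and a Stirling bound -/

/-- Foster's drift criterion: a nonnegative function with geometric drift has a finite integral with
respect to a stationary measure, without any a priori integrability. -/
theorem lintegral_le_of_geometric_drift {X Y Ξ : Type*} [MeasurableSpace X] [MeasurableSpace Y]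
    [MeasurableSpace Ξ] {ν : Measure X} {ρ : Measure Y} {μ : Measure Ξ}
    [IsProbabilityMeasure ρ] [IsProbabilityMeasure μ] {p : Y → X} {Φ : Y × Ξ → X}
    (hp : Measurable p) (hΦ : Measurable Φ) (hν : ρ.map p = ν) (hst : (ρ.prod μ).map Φ = ν)
    {W : X → ℝ≥0∞} (hW : Measurable W) (hfin : ∀ x, W x ≠ ∞) {γ K : ℝ≥0∞} (hγ : γ < 1)
    (hdrift : ∀ᵐ y ∂ρ, ∫⁻ ξ, W (Φ (y, ξ)) ∂μ ≤ γ * W (p y) + K) :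
    ∫⁻ x, W x ∂ν ≤ K * (1 - γ)⁻¹ := by
  have hprob : IsProbabilityMeasure ν := by
    rw [← hν]; exact Measure.isProbabilityMeasure_map hp.aemeasurable
  set k : ℕ → ℝ≥0∞ := fun n => K * ∑ i ∈ Finset.range n, γ ^ i with hk
  have hkle : ∀ n, k n ≤ K * (1 - γ)⁻¹ := fun n => by
    rw [← ENNReal.tsum_geometric]
    exact mul_le_mul_right (ENNReal.sum_le_tsum _) _
  -- Truncation at `m` keeps both sides finite although `W` may not be integrable. Each use of
  -- stationarity applies the drift once inside the truncation. Then `n → ∞` kills `γ ^ n * W` by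
  -- dominated convergence, and `m → ∞` removes the truncation.
  have key : ∀ m : ℕ, ∀ n : ℕ,
      ∫⁻ x, min (W x) m ∂ν ≤ ∫⁻ x, min (γ ^ n * W x + k n) m ∂ν := by
    intro m n
    induction n with
    | zero => simp [hk]
    | succ n ih =>
      refine ih.trans ?_
      have hmeas : Measurable fun x => min (γ ^ n * W x + k n) (m : ℝ≥0∞) := by fun_prop
      have hmeas' : Measurable fun x => min (γ ^ (n + 1) * W x + k (n + 1)) (m : ℝ≥0∞) := by
        fun_prop
      conv_lhs => rw [← hst]
      conv_rhs => rw [← hν]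
      rw [lintegral_map hmeas hΦ, lintegral_map hmeas' hp,
        lintegral_prod (fun z => min (γ ^ n * W (Φ z) + k n) (m : ℝ≥0∞))
          (hmeas.comp hΦ).aemeasurable]
      refine lintegral_mono_ae ?_
      filter_upwards [hdrift] with y hy
      refine le_min ?_ ?_
      · calc ∫⁻ ξ, min (γ ^ n * W (Φ (y, ξ)) + k n) m ∂μ
            ≤ ∫⁻ ξ, (γ ^ n * W (Φ (y, ξ)) + k n) ∂μ := lintegral_mono fun ξ => min_le_left _ _
          _ = γ ^ n * ∫⁻ ξ, W (Φ (y, ξ)) ∂μ + k n := by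
              rw [lintegral_add_right _ measurable_const, lintegral_const_mul]
              · simp
              · exact hW.comp (hΦ.comp measurable_prodMk_left)
          _ ≤ γ ^ n * (γ * W (p y) + K) + k n := by gcongr
          _ = γ ^ (n + 1) * W (p y) + k (n + 1) := by
              simp only [hk, Finset.sum_range_succ]; ring
      · calc ∫⁻ ξ, min (γ ^ n * W (Φ (y, ξ)) + k n) m ∂μ
            ≤ ∫⁻ _, (m : ℝ≥0∞) ∂μ := lintegral_mono fun ξ => min_le_right _ _
          _ = m := by simp
  have hlim : ∀ m : ℕ, ∫⁻ x, min (W x) m ∂ν ≤ K * (1 - γ)⁻¹ := by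
    intro m
    have h1 : ∀ n, ∫⁻ x, min (W x) m ∂ν ≤ ∫⁻ x, min (γ ^ n * W x + K * (1 - γ)⁻¹) m ∂ν := fun n =>
      (key m n).trans (lintegral_mono fun x => by gcongr; exact hkle n)
    have h2 : Tendsto (fun n : ℕ => ∫⁻ x, min (γ ^ n * W x + K * (1 - γ)⁻¹) m ∂ν) atTop
        (𝓝 (∫⁻ _, min (K * (1 - γ)⁻¹) m ∂ν)) := by
      refine tendsto_lintegral_of_dominated_convergence (fun _ => (m : ℝ≥0∞))
        (fun n => by fun_prop) (fun n => ae_of_all _ fun x => min_le_right _ _) (by simp)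
        (ae_of_all _ fun x => ?_)
      have h3 : Tendsto (fun n : ℕ => γ ^ n * W x) atTop (𝓝 (0 * W x)) :=
        ENNReal.Tendsto.mul_const (ENNReal.tendsto_pow_atTop_nhds_zero_of_lt_one hγ)
          (Or.inr (hfin x))
      have h4 := (h3.add_const (K * (1 - γ)⁻¹)).min (tendsto_const_nhds (x := (m : ℝ≥0∞)))
      simpa using h4
    refine (ge_of_tendsto' h2 h1).trans ?_
    simp
  have hmono : ∫⁻ x, W x ∂ν = ⨆ m : ℕ, ∫⁻ x, min (W x) m ∂ν := by
    rw [← lintegral_iSup (f := fun (m : ℕ) x => min (W x) (m : ℝ≥0∞)) (fun m => by fun_prop)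
      (fun a b hab x => min_le_min le_rfl (by exact_mod_cast hab))]
    refine lintegral_congr fun x => ?_
    refine le_antisymm ?_ (iSup_le fun m => min_le_left _ _)
    obtain ⟨m, hm⟩ := ENNReal.exists_nat_gt (hfin x)
    exact le_iSup_of_le m (le_min le_rfl hm.le)
  rw [hmono]
  exact iSup_le hlim

/-- Upper bound of Stirling type on the factorial. -/
theorem factorial_le_rpow_mul_exp {r : ℕ} (hr : 1 ≤ r) :
    (r.factorial : ℝ) ≤ (r : ℝ) ^ ((r : ℝ) + 1 / 2) * Real.exp (1 - r) := by
  obtain ⟨n, rfl⟩ : ∃ n, r = n + 1 := ⟨r - 1, by omega⟩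
  -- The sequence `r! / (√(2r) (r/e)^r)` decreases from its value `e / √2` at `r = 1`; the factors
  -- `√2` cancel.
  have h := Stirling.log_stirlingSeq'_antitone (Nat.zero_le n)
  simp only [Function.comp_apply, Stirling.log_stirlingSeq_formula] at h
  have hpos : (0 : ℝ) < ((n + 1 : ℕ) : ℝ) := by positivity
  set x : ℝ := ((n + 1 : ℕ) : ℝ) with hx
  have e1 : Real.log (2 * x) = Real.log 2 + Real.log x := Real.log_mul two_ne_zero hpos.ne'
  have e2 : Real.log (x / Real.exp 1) = Real.log x - 1 := by
    rw [Real.log_div hpos.ne' (Real.exp_ne_zero _), Real.log_exp]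
  simp only [Nat.succ_eq_add_one, e1, e2] at h
  norm_num at h
  have hf : (0 : ℝ) < ((n + 1).factorial : ℝ) := by positivity
  rw [← Real.log_le_log_iff hf (by positivity), Real.log_mul (by positivity) (by positivity),
    Real.log_rpow hpos, Real.log_exp]
  linarith

/-! ### Stein's equation for the exponential distribution -/

theorem integral_expMeasure_one (f : ℝ → ℝ) :
    ∫ x, f x ∂(expMeasure 1) = ∫ x in Set.Ioi (0 : ℝ), Real.exp (-x) * f x := by
  rw [expMeasure, gammaMeasure]
  have h0 : gammaPDF 1 1 = fun x => ENNReal.ofReal (gammaPDFReal 1 1 x) := rfl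
  rw [h0, integral_withDensity_eq_integral_toReal_smul
    (measurable_gammaPDFReal 1 1).ennreal_ofReal (ae_of_all _ fun _ => ENNReal.ofReal_lt_top),
    ← integral_Ici_eq_integral_Ioi, ← integral_indicator measurableSet_Ici]
  refine integral_congr_ae (ae_of_all _ fun x => ?_)
  by_cases hx : 0 ≤ x
  · simp [gammaPDFReal, hx, Set.indicator, Real.exp_nonneg]
  · simp [gammaPDFReal, hx, Set.indicator]

theorem LipschitzWith.abs_sub_le {h : ℝ → ℝ} {K : NNReal} (hh : LipschitzWith K h) (x y : ℝ) :
    |h x - h y| ≤ K * |x - y| := by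
  simpa [Real.dist_eq] using hh.dist_le_mul x y

theorem integrable_id_expMeasure_one : Integrable (fun x : ℝ => x) (expMeasure 1) := by
  have h1 : IntegrableOn (fun x : ℝ => Real.exp (-x) * x) (Set.Ici 0) := by
    rw [integrableOn_Ici_iff_integrableOn_Ioi]
    have := Real.GammaIntegral_convergent (s := 2) two_pos
    refine this.congr_fun (fun x hx => ?_) measurableSet_Ioi
    norm_num
  rw [expMeasure, gammaMeasure]
  have h0 : gammaPDF 1 1 = fun x => ENNReal.ofReal (gammaPDFReal 1 1 x) := rfl
  rw [h0, integrable_withDensity_iff (measurable_gammaPDFReal 1 1).ennreal_ofReal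
    (ae_of_all _ fun _ => ENNReal.ofReal_lt_top)]
  rw [← integrable_indicator_iff measurableSet_Ici] at h1
  refine h1.congr (ae_of_all _ fun x => ?_)
  by_cases hx : 0 ≤ x
  · simp [gammaPDFReal, hx, Set.indicator, Real.exp_nonneg, mul_comm]
  · simp [gammaPDFReal, hx, Set.indicator]

theorem LipschitzWith.integrable_of_integrable_id {h : ℝ → ℝ} {K : NNReal}
    (hh : LipschitzWith K h) {Ω : Type*} [MeasurableSpace Ω] {ν : Measure Ω} [IsFiniteMeasure ν]
    {X : Ω → ℝ} (hX : Integrable X ν) : Integrable (fun ω => h (X ω)) ν := by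
  refine Integrable.mono' (g := fun ω => |h 0| + K * |X ω|)
    ((integrable_const _).add (hX.abs.const_mul _))
    (hh.continuous.comp_aestronglyMeasurable hX.1) (ae_of_all _ fun ω => ?_)
  have := hh.abs_sub_le (X ω) 0
  rw [sub_zero] at this
  rw [Real.norm_eq_abs]
  have h2 := abs_sub_abs_le_abs_sub (h (X ω)) (h 0)
  linarith

/-- The solution of the first order Stein equation `g' - g = h - E h(Z)`, `g(0) = 0`, of the
exponential distribution with mean one. -/
def expSteinSolution (h : ℝ → ℝ) (x : ℝ) : ℝ :=
  ∫ s, h s ∂(expMeasure 1) - ∫ s, h (x + s) ∂(expMeasure 1)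

section Stein

variable {h : ℝ → ℝ}

theorem isProbabilityMeasure_expMeasure_one : IsProbabilityMeasure (expMeasure 1) :=
  isProbabilityMeasure_expMeasure one_pos

theorem expSteinSolution_zero : expSteinSolution h 0 = 0 := by simp [expSteinSolution]

theorem integrable_shift_expMeasure (hh : LipschitzWith 1 h) (x : ℝ) :
    Integrable (fun s => h (x + s)) (expMeasure 1) := by
  have := isProbabilityMeasure_expMeasure_one
  exact hh.integrable_of_integrable_id ((integrable_const x).add integrable_id_expMeasure_one)

theorem abs_expSteinSolution_sub_le (hh : LipschitzWith 1 h) (x y : ℝ) :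
    |expSteinSolution h x - expSteinSolution h y| ≤ |x - y| := by
  have := isProbabilityMeasure_expMeasure_one
  have e : expSteinSolution h x - expSteinSolution h y
      = ∫ s, (h (y + s) - h (x + s)) ∂(expMeasure 1) := by
    rw [integral_sub (integrable_shift_expMeasure hh y) (integrable_shift_expMeasure hh x)]
    simp only [expSteinSolution]; ring
  rw [e, ← Real.norm_eq_abs]
  refine (norm_integral_le_of_norm_le_const (C := |x - y|) (ae_of_all _ fun s => ?_)).trans (by simp)
  have := hh.abs_sub_le (y + s) (x + s)
  rw [Real.norm_eq_abs]
  simpa [abs_sub_comm] using this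

theorem integrableOn_exp_neg_mul (hh : LipschitzWith 1 h) (a : ℝ) :
    IntegrableOn (fun t => Real.exp (-t) * h t) (Set.Ioi a) := by
  have h0 : IntegrableOn (fun t => Real.exp (-t) * h t) (Set.Ioi 0) := by
    have h1 : IntegrableOn (fun x : ℝ => Real.exp (-x) * x) (Set.Ioi 0) := by
      have := Real.GammaIntegral_convergent (s := 2) two_pos
      refine this.congr_fun (fun x hx => ?_) measurableSet_Ioi
      norm_num
    have h2 : IntegrableOn (fun x : ℝ => Real.exp (-x)) (Set.Ioi 0) := integrableOn_exp_neg_Ioi 0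
    refine Integrable.mono' (g := fun t => |h 0| * Real.exp (-t) + Real.exp (-t) * t)
      ((h2.const_mul _).add h1) ?_ ?_
    · have := hh.continuous
      exact Continuous.aestronglyMeasurable (by fun_prop)
    · filter_upwards [ae_restrict_mem measurableSet_Ioi] with t ht
      rw [norm_mul, Real.norm_eq_abs, Real.norm_eq_abs, Real.abs_exp]
      have := hh.abs_sub_le t 0
      rw [sub_zero, abs_of_pos (show (0 : ℝ) < t from ht)] at this
      have h2 := abs_sub_abs_le_abs_sub (h t) (h 0)
      have h3 : |h t| ≤ |h 0| + t := by simp at this; linarith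
      nlinarith [Real.exp_pos (-t)]
  rcases le_total a 0 with ha | ha
  · have := hh.continuous
    have hc : IntegrableOn (fun t => Real.exp (-t) * h t) (Set.Ioc a 0) :=
      (Continuous.integrableOn_Icc (by fun_prop)).mono_set Set.Ioc_subset_Icc_self
    rw [← Set.Ioc_union_Ioi_eq_Ioi ha]
    exact hc.union h0
  · exact h0.mono_set (Set.Ioi_subset_Ioi ha)

/-- The substitution `t = x + s` moves `x` from the argument of `h` to an endpoint of integration,
so that a merely Lipschitz `h` suffices for differentiability. It holds for negative `x` too, which
is needed because the solution is later evaluated at points shifted below zero. -/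
theorem expSteinSolution_eq (hh : LipschitzWith 1 h) (x : ℝ) :
    expSteinSolution h x = ∫ s, h s ∂(expMeasure 1) -
      Real.exp x * (∫ s, h s ∂(expMeasure 1) - ∫ t in (0 : ℝ)..x, Real.exp (-t) * h t) := by
  have e1 : ∫ s, h (x + s) ∂(expMeasure 1)
      = Real.exp x * ∫ t in Set.Ioi x, Real.exp (-t) * h t := by
    rw [integral_expMeasure_one, ← integral_const_mul]
    rw [← integral_indicator measurableSet_Ioi, ← integral_indicator measurableSet_Ioi,
      ← integral_add_left_eq_self
        ((Set.Ioi x).indicator fun t => Real.exp x * (Real.exp (-t) * h t)) x]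
    refine integral_congr_ae (ae_of_all _ fun t => ?_)
    by_cases ht : 0 < t
    · simp only [Set.indicator, Set.mem_Ioi, ht, lt_add_iff_pos_right, if_true]
      rw [← mul_assoc, ← Real.exp_add]
      ring_nf
    · simp [Set.indicator, ht]
  rw [expSteinSolution, e1, integral_expMeasure_one,
    ← intervalIntegral.integral_interval_add_Ioi (integrableOn_exp_neg_mul hh 0)
      (integrableOn_exp_neg_mul hh x)]
  ring

theorem hasDerivAt_expSteinSolution (hh : LipschitzWith 1 h) (x : ℝ) :
    HasDerivAt (expSteinSolution h)
      (expSteinSolution h x + h x - ∫ s, h s ∂(expMeasure 1)) x := by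
  have hc := hh.continuous
  have hI : HasDerivAt (fun y => ∫ t in (0 : ℝ)..y, Real.exp (-t) * h t)
      (Real.exp (-x) * h x) x :=
    (Continuous.deriv_integral (fun t => Real.exp (-t) * h t) (by fun_prop) 0 x) ▸
      (intervalIntegral.differentiable_integral_of_continuous (a := 0)
        (f := fun t => Real.exp (-t) * h t) (by fun_prop) x).hasDerivAt
  have hd := (((Real.hasDerivAt_exp x).mul (hI.const_sub (∫ s, h s ∂(expMeasure 1)))).const_sub
    (∫ s, h s ∂(expMeasure 1)))
  have hfun : expSteinSolution h = fun y => ∫ s, h s ∂(expMeasure 1) -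
      Real.exp y * (∫ s, h s ∂(expMeasure 1) - ∫ t in (0 : ℝ)..y, Real.exp (-t) * h t) :=
    funext fun y => expSteinSolution_eq hh y
  have hexp : Real.exp x * Real.exp (-x) = 1 := by rw [← Real.exp_add]; simp
  rw [expSteinSolution_eq hh x, hfun]
  refine hd.congr_deriv ?_
  linear_combination h x * hexp

/-- The derivative of the Stein solution. -/
def expSteinDeriv (h : ℝ → ℝ) (x : ℝ) : ℝ :=
  expSteinSolution h x + h x - ∫ s, h s ∂(expMeasure 1)

/-- By the Stein equation the derivative is a sum of two 1-Lipschitz functions and a constant, so no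
derivative of `h` is needed. -/
theorem abs_expSteinDeriv_sub_le (hh : LipschitzWith 1 h) (x y : ℝ) :
    |expSteinDeriv h x - expSteinDeriv h y| ≤ 2 * |x - y| := by
  have h1 := abs_expSteinSolution_sub_le hh x y
  have h2 := hh.abs_sub_le x y
  have e : expSteinDeriv h x - expSteinDeriv h y
      = (expSteinSolution h x - expSteinSolution h y) + (h x - h y) := by
    simp only [expSteinDeriv]; ring
  rw [e]
  refine (abs_add_le _ _).trans ?_
  simp at h2
  linarith

/-- A primitive of the Stein solution. -/
def expSteinPrimitive (h : ℝ → ℝ) (x : ℝ) : ℝ := ∫ t in (0 : ℝ)..x, expSteinSolution h t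

theorem continuous_expSteinSolution (hh : LipschitzWith 1 h) : Continuous (expSteinSolution h) :=
  continuous_iff_continuousAt.2 fun x => (hasDerivAt_expSteinSolution hh x).continuousAt

theorem hasDerivAt_expSteinPrimitive (hh : LipschitzWith 1 h) (x : ℝ) :
    HasDerivAt (expSteinPrimitive h) (expSteinSolution h x) x :=
  (Continuous.deriv_integral _ (continuous_expSteinSolution hh) 0 x) ▸
    (intervalIntegral.differentiable_integral_of_continuous (a := 0)
      (continuous_expSteinSolution hh) x).hasDerivAt

theorem abs_sub_le_of_hasDerivAt_of_abs_le {φ φ' : ℝ → ℝ} {t B : ℝ}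
    (hφ : ∀ s, HasDerivAt φ (φ' s) s) (hB : ∀ s, |s| ≤ |t| → |φ' s| ≤ B) :
    |φ t - φ 0| ≤ B * |t| := by
  have := Convex.norm_image_sub_le_of_norm_hasDerivWithin_le (s := Set.uIcc 0 t) (f := φ) (f' := φ')
    (C := B) (x := 0) (y := t)
    (fun x _ => (hφ x).hasDerivWithinAt) (fun s hs => hB s ?_) (convex_uIcc 0 t)
    Set.left_mem_uIcc Set.right_mem_uIcc
  · simpa using this
  · have := Set.abs_sub_left_of_mem_uIcc hs
    simpa using this

theorem abs_expSteinPrimitive_add_sub_le (hh : LipschitzWith 1 h) (x t : ℝ) :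
    |expSteinPrimitive h (x + t) - expSteinPrimitive h x - t * expSteinSolution h x| ≤ t ^ 2 := by
  have hd : ∀ s, HasDerivAt (fun s => expSteinPrimitive h (x + s) - s * expSteinSolution h x)
      (expSteinSolution h (x + s) - expSteinSolution h x) s := fun s => by
    have h1 := (hasDerivAt_expSteinPrimitive hh (x + s)).comp_const_add x s
    exact (h1.sub ((hasDerivAt_id s).mul_const (expSteinSolution h x))).congr_deriv (by simp)
  have := abs_sub_le_of_hasDerivAt_of_abs_le (t := t) (B := |t|) hd fun s hs => by
    have := abs_expSteinSolution_sub_le hh (x + s) x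
    simp only [add_sub_cancel_left] at this
    exact this.trans hs
  rw [abs_mul_abs_self, ← sq] at this
  refine le_trans (le_of_eq ?_) this
  congr 1
  simp; ring

/-- The mean value inequality is applied twice, starting from the 2-Lipschitz derivative of the
solution. Bounding by suprema instead of integrating accounts for the non-optimal constant. -/
theorem abs_expSteinPrimitive_taylor_le (hh : LipschitzWith 1 h) (x t : ℝ) :
    |expSteinPrimitive h (x + t) - expSteinPrimitive h x - t * expSteinSolution h x
      - t ^ 2 / 2 * expSteinDeriv h x| ≤ 2 * |t| ^ 3 := by
  have hd1 : ∀ s, HasDerivAt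
      (fun s => expSteinSolution h (x + s) - s * expSteinDeriv h x)
      (expSteinDeriv h (x + s) - expSteinDeriv h x) s := fun s => by
    have h1 := (hasDerivAt_expSteinSolution hh (x + s)).comp_const_add x s
    exact (h1.sub ((hasDerivAt_id s).mul_const (expSteinDeriv h x))).congr_deriv
      (by simp [expSteinDeriv])
  have h1 : ∀ s, |expSteinSolution h (x + s) - expSteinSolution h x - s * expSteinDeriv h x|
      ≤ 2 * |s| ^ 2 := fun s => by
    have := abs_sub_le_of_hasDerivAt_of_abs_le (t := s) (B := 2 * |s|) hd1 fun r hr => by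
      have := abs_expSteinDeriv_sub_le hh (x + r) x
      simp only [add_sub_cancel_left] at this
      linarith
    refine le_trans (le_of_eq ?_) (this.trans (le_of_eq (by ring)))
    congr 1
    simp; ring
  have hd2 : ∀ s, HasDerivAt
      (fun s => expSteinPrimitive h (x + s) - s * expSteinSolution h x
        - s ^ 2 / 2 * expSteinDeriv h x)
      (expSteinSolution h (x + s) - expSteinSolution h x - s * expSteinDeriv h x) s := fun s => by
    have h1 := (hasDerivAt_expSteinPrimitive hh (x + s)).comp_const_add x s
    have h2 := (((hasDerivAt_id s).pow 2).div_const 2).mul_const (expSteinDeriv h x)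
    have h3 := (h1.sub ((hasDerivAt_id s).mul_const (expSteinSolution h x))).sub h2
    refine h3.congr_deriv ?_
    simp
  have := abs_sub_le_of_hasDerivAt_of_abs_le (t := t) (B := 2 * |t| ^ 2) hd2 fun s hs =>
    (h1 s).trans (by gcongr)
  refine le_trans (le_of_eq ?_) (this.trans (le_of_eq (by ring)))
  congr 1
  simp; ring

end Stein

/-! ### Vanishing of the bound for `α > 2` -/

namespace LoadBalancingSystem

theorem tendsto_wassersteinBound (α σa σs smax C : ℝ) (hα : 2 < α) :
    Tendsto (fun N : ℕ => wassersteinBound N α σa σs smax C) atTop (𝓝 0) := by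
  have hneg : ∀ β : ℝ, β < 0 → Tendsto (fun N : ℕ => (N : ℝ) ^ β) atTop (𝓝 0) := fun β hβ => by
    have := (tendsto_rpow_neg_atTop (neg_pos.2 hβ)).comp tendsto_natCast_atTop_atTop
    simpa [Function.comp_def] using this
  have hlog : Tendsto (fun N : ℕ => (N : ℝ) ^ (2 - α) * (⌈Real.log N⌉ : ℝ)) atTop (𝓝 0) := by
    have h1 : Tendsto (fun x : ℝ => Real.log x / x ^ (α - 2)) atTop (𝓝 0) :=
      (isLittleO_log_rpow_atTop (sub_pos.2 hα)).tendsto_div_nhds_zero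
    have h2 := (h1.comp tendsto_natCast_atTop_atTop).add (hneg (2 - α) (by linarith))
    rw [add_zero] at h2
    refine squeeze_zero' (Eventually.of_forall fun N => ?_) ?_ h2
    · have : (0 : ℝ) ≤ (⌈Real.log N⌉ : ℝ) := by
        exact_mod_cast Int.ceil_nonneg (Real.log_natCast_nonneg N)
      positivity
    · filter_upwards [eventually_gt_atTop 0] with N hN
      have hN' : (0 : ℝ) < N := by exact_mod_cast hN
      have e : (N : ℝ) ^ (2 - α) = 1 / (N : ℝ) ^ (α - 2) := by
        rw [one_div, ← Real.rpow_neg hN'.le]; ring_nf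
      have hc := (Int.ceil_lt_add_one (Real.log N)).le
      calc (N : ℝ) ^ (2 - α) * (⌈Real.log N⌉ : ℝ)
          ≤ (N : ℝ) ^ (2 - α) * (Real.log N + 1) := by gcongr
        _ = _ := by simp only [Function.comp_apply]; rw [e]; ring
  have h := ((((hneg (1 - α) (by linarith)).const_mul (5 * smax)).add
    (hneg (1 - 2 * α) (by linarith))).add
      (hlog.const_mul (2 * (C * smax * Real.exp (1 / (2 * Real.exp 1) + 1)) * (⌈α - 1⌉ : ℝ)))).const_mul
        (1 / (σa ^ 2 + σs ^ 2))
  simp only [mul_zero, add_zero] at h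
  refine h.congr fun N => ?_
  rw [wassersteinBound]; ring

end LoadBalancingSystem

/-! ### Stationarity and the one-slot representation -/

theorem PMF.lintegral_bind_toMeasure {X Y : Type*} [MeasurableSpace X] [Countable X]
    [MeasurableSingletonClass X] [MeasurableSpace Y] [Countable Y] [MeasurableSingletonClass Y]
    (p : PMF X) (κ : X → PMF Y) (f : Y → ℝ≥0∞) :
    ∫⁻ y, f y ∂(p.bind κ).toMeasure = ∫⁻ x, ∫⁻ y, f y ∂(κ x).toMeasure ∂p.toMeasure := by
  simp only [lintegral_countable', PMF.toMeasure_apply_singleton _ _ (measurableSet_singleton _),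
    PMF.bind_apply]
  simp_rw [← ENNReal.tsum_mul_left, ← ENNReal.tsum_mul_right]
  rw [ENNReal.tsum_comm]
  refine tsum_congr fun x => tsum_congr fun y => ?_
  ring

theorem PMF.lintegral_pure_toMeasure {X : Type*} [MeasurableSpace X] [Countable X]
    [MeasurableSingletonClass X] (x : X) (f : X → ℝ≥0∞) :
    ∫⁻ y, f y ∂(PMF.pure x).toMeasure = f x := by
  rw [PMF.toMeasure_pure, lintegral_dirac]

namespace LoadBalancingSystem

section Noise

variable {N : ℕ} (S : LoadBalancingSystem N)

/-- The law of the arrivals and the potential services of one time slot. -/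
def noise : Measure (ℕ × (Fin N → ℕ)) :=
  S.arrival.toMeasure.prod (Measure.pi fun i => (S.service i).toMeasure)

instance : IsProbabilityMeasure S.noise := by unfold noise; infer_instance

end Noise

variable {N : ℕ} [NeZero N]

/-- On a discrete state space every bounded function is a valid test function. Testing the laws with
`q ↦ S.jsqStep q x`, and the laws one slot later with the indicator of `x`, gives two limits of the
same sequence. -/
theorem IsSteadyState.bind_jsqStep {S : LoadBalancingSystem N} {π : PMF (Fin N → ℕ)}
    (h : S.IsSteadyState π) : π.bind S.jsqStep = π := by
  obtain ⟨μ₀, hμ⟩ := h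
  rw [ProbabilityMeasure.tendsto_iff_forall_lintegral_tendsto] at hμ
  refine PMF.ext fun x => ?_
  have hle : ∀ q, S.jsqStep q x ≤ 1 := fun q => PMF.coe_le_one _ _
  have bdd : ∀ φ : (Fin N → ℕ) → NNReal, (∀ q, φ q ≤ 1) →
      Tendsto (fun k => ∫⁻ q, φ q ∂(S.queueLaw μ₀ k).toMeasure) atTop
        (𝓝 (∫⁻ q, φ q ∂π.toMeasure)) := fun φ hφ => by
    exact hμ (BoundedContinuousFunction.mkOfDiscrete φ 1 fun q r => by
      rw [NNReal.dist_eq, abs_le]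
      have h1 : (φ q : ℝ) ≤ 1 := hφ q
      have h2 : (φ r : ℝ) ≤ 1 := hφ r
      constructor <;> linarith [(φ q).coe_nonneg, (φ r).coe_nonneg])
  have h1 := bdd (fun q => (S.jsqStep q x).toNNReal) fun q => by
    simpa using ENNReal.toNNReal_mono ENNReal.one_ne_top (hle q)
  have h2 := (bdd (fun q => if q = x then 1 else 0) fun q => by split <;> simp).comp
    (tendsto_add_atTop_nat 1)
  have e1 : ∀ p : PMF (Fin N → ℕ),
      ∫⁻ q, ((S.jsqStep q x).toNNReal : ℝ≥0∞) ∂p.toMeasure = p.bind S.jsqStep x := fun p => by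
    simp only [lintegral_countable', PMF.toMeasure_apply_singleton _ _ (measurableSet_singleton _),
      PMF.bind_apply, ENNReal.coe_toNNReal ((hle _).trans_lt ENNReal.one_lt_top).ne, mul_comm]
  have e2 : ∀ p : PMF (Fin N → ℕ),
      ∫⁻ q, ((if q = x then 1 else 0 : NNReal) : ℝ≥0∞) ∂p.toMeasure = p x := fun p => by
    simp only [lintegral_countable', PMF.toMeasure_apply_singleton _ _ (measurableSet_singleton _)]
    rw [tsum_eq_single x (by simp +contextual)]
    simp
  simp only [e1] at h1
  simp only [Function.comp_def, e2] at h2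
  exact tendsto_nhds_unique h1 h2

/-- The joint law of the queue lengths and of the queue chosen by the dispatcher. -/
def dispatchLaw (π : PMF (Fin N → ℕ)) : Measure ((Fin N → ℕ) × Fin N) :=
  (π.bind fun q => (PMF.uniformOfFinset (shortestQueues q) (shortestQueues_nonempty q)).bind
    fun i => PMF.pure (q, i)).toMeasure

instance (π : PMF (Fin N → ℕ)) : IsProbabilityMeasure (dispatchLaw π) := by
  unfold dispatchLaw; infer_instance

theorem lintegral_dispatchLaw (π : PMF (Fin N → ℕ)) (f : (Fin N → ℕ) × Fin N → ℝ≥0∞) :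
    ∫⁻ y, f y ∂(dispatchLaw π) = ∫⁻ q, ∫⁻ i, f (q, i)
      ∂(PMF.uniformOfFinset (shortestQueues q) (shortestQueues_nonempty q)).toMeasure
        ∂π.toMeasure := by
  simp only [dispatchLaw, PMF.lintegral_bind_toMeasure, PMF.lintegral_pure_toMeasure]

theorem map_fst_dispatchLaw (π : PMF (Fin N → ℕ)) :
    (dispatchLaw π).map Prod.fst = π.toMeasure := by
  refine Measure.ext_of_lintegral _ fun f hf => ?_
  rw [lintegral_map hf measurable_fst, lintegral_dispatchLaw]
  simp

theorem ae_mem_shortestQueues (π : PMF (Fin N → ℕ)) :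
    ∀ᵐ y ∂(dispatchLaw π), y.2 ∈ shortestQueues y.1 := by
  rw [ae_iff, ← lintegral_indicator_one (DiscreteMeasurableSpace.forall_measurableSet _),
    lintegral_dispatchLaw]
  have : ∀ q : Fin N → ℕ, ∫⁻ i, {a : (Fin N → ℕ) × Fin N | a.2 ∉ shortestQueues a.1}.indicator
      (1 : (Fin N → ℕ) × Fin N → ℝ≥0∞) (q, i)
      ∂(PMF.uniformOfFinset (shortestQueues q) (shortestQueues_nonempty q)).toMeasure = 0 := by
    intro q
    rw [lintegral_fintype]
    refine Finset.sum_eq_zero fun i _ => ?_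
    rw [PMF.toMeasure_apply_singleton _ _ (measurableSet_singleton _)]
    by_cases hi : i ∈ shortestQueues q
    · simp [hi]
    · rw [PMF.uniformOfFinset_apply_of_notMem _ hi, mul_zero]
  simp [this]

/-- The queue lengths after one time slot as a function of the current queue lengths, the chosen
queue, the arrivals and the potential services. -/
def stepMap (z : ((Fin N → ℕ) × Fin N) × (ℕ × (Fin N → ℕ))) : Fin N → ℕ :=
  nextQueues z.1.1 z.1.2 z.2.1 z.2.2

/-- This form exhibits the pair of state and chosen queue as independent of the noise, so that
expectations of products over one slot factor. -/
theorem map_stepMap_dispatchLaw {S : LoadBalancingSystem N} {π : PMF (Fin N → ℕ)}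
    (h : π.bind S.jsqStep = π) :
    ((dispatchLaw π).prod S.noise).map stepMap = π.toMeasure := by
  refine Measure.ext_of_lintegral _ fun f hf => ?_
  rw [lintegral_map hf Measurable.of_discrete, lintegral_prod _ Measurable.of_discrete.aemeasurable,
    lintegral_dispatchLaw]
  conv_rhs => rw [← h]
  simp only [PMF.lintegral_bind_toMeasure, jsqStep, PMF.lintegral_pure_toMeasure, serviceVector,
    Measure.toPMF_toMeasure, noise, stepMap]
  refine lintegral_congr fun q => lintegral_congr fun i => ?_
  rw [lintegral_prod _ Measurable.of_discrete.aemeasurable]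

end LoadBalancingSystem

/-! ### Bounds and moments of the one-slot noise -/

theorem PMF.ae_mem_support {X : Type*} [MeasurableSpace X] [DiscreteMeasurableSpace X] (p : PMF X) :
    ∀ᵐ x ∂p.toMeasure, x ∈ p.support := by
  rw [ae_iff, PMF.toMeasure_apply_eq_zero_iff _ (DiscreteMeasurableSpace.forall_measurableSet _)]
  exact Set.disjoint_left.2 fun x hx hx' => hx' hx

namespace LoadBalancingSystem

section Noise

variable {N : ℕ} {S : LoadBalancingSystem N} {α σa σs amax smax M : ℝ}

theorem IsParametrized.ae_arrival_le (h : S.IsParametrized α σa σs amax smax)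
    (hM : max amax smax ≤ M) : ∀ᵐ n : ℕ ∂S.arrival.toMeasure, (n : ℝ) ≤ M := by
  filter_upwards [S.arrival.ae_mem_support] with n hn
  exact (h.arrival_le n hn).trans ((le_max_left _ _).trans hM)

theorem IsParametrized.ae_service_le (h : S.IsParametrized α σa σs amax smax)
    (hM : max amax smax ≤ M) (i : Fin N) : ∀ᵐ n : ℕ ∂(S.service i).toMeasure, (n : ℝ) ≤ M := by
  filter_upwards [(S.service i).ae_mem_support] with n hn
  exact (h.service_le i n hn).trans ((le_max_right _ _).trans hM)

theorem memLp_two_of_ae_le {ν : Measure ℕ} [IsProbabilityMeasure ν]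
    (h : ∀ᵐ n : ℕ ∂ν, (n : ℝ) ≤ M) : MemLp (fun n : ℕ => (n : ℝ)) 2 ν :=
  MemLp.of_bound Measurable.of_discrete.aestronglyMeasurable M
    (by filter_upwards [h] with n hn; simpa using hn)

theorem integrable_natCast_of_ae_le {ν : Measure ℕ} [IsProbabilityMeasure ν]
    (h : ∀ᵐ n : ℕ ∂ν, (n : ℝ) ≤ M) : Integrable (fun n : ℕ => (n : ℝ)) ν :=
  (memLp_two_of_ae_le h).integrable one_le_two

theorem integral_natCast_le_of_ae_le {ν : Measure ℕ} [IsProbabilityMeasure ν]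
    (h : ∀ᵐ n : ℕ ∂ν, (n : ℝ) ≤ M) : ∫ n, (n : ℝ) ∂ν ≤ M := by
  have := integral_mono_ae (integrable_natCast_of_ae_le h) (integrable_const M) h
  simpa using this

/-- With load at least `δ` this yields `N ≤ M / δ`, the source of all uniformity in `N`. -/
theorem IsParametrized.arrival_mean_le (h : S.IsParametrized α σa σs amax smax)
    (hM : max amax smax ≤ M) : N * (1 - (N : ℝ) ^ (-α)) ≤ M :=
  h.arrival_mean ▸ integral_natCast_le_of_ae_le (h.ae_arrival_le hM)

theorem IsParametrized.one_le_smax [NeZero N] (h : S.IsParametrized α σa σs amax smax) :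
    1 ≤ smax := by
  rw [← h.service_mean 0]
  refine integral_natCast_le_of_ae_le ?_
  filter_upwards [(S.service 0).ae_mem_support] with n hn using h.service_le 0 n hn

theorem IsParametrized.ae_noise (h : S.IsParametrized α σa σs amax smax)
    (hM : max amax smax ≤ M) :
    ∀ᵐ ξ ∂S.noise, (ξ.1 : ℝ) ≤ M ∧ ∀ i, (ξ.2 i : ℝ) ≤ M := by
  have h1 : ∀ᵐ ξ ∂S.noise, (ξ.1 : ℝ) ≤ M :=
    (Measure.quasiMeasurePreserving_fst (μ := S.arrival.toMeasure)).ae (h.ae_arrival_le hM)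
  have h2 : ∀ i, ∀ᵐ ξ ∂S.noise, (ξ.2 i : ℝ) ≤ M := fun i =>
    (Measure.quasiMeasurePreserving_snd (μ := S.arrival.toMeasure)).ae
      ((measurePreserving_eval (fun i => (S.service i).toMeasure) i).quasiMeasurePreserving.ae
        (h.ae_service_le hM i))
  filter_upwards [h1, ae_all_iff.2 h2] with ξ a b using ⟨a, b⟩

theorem IsParametrized.integrable_arrival (h : S.IsParametrized α σa σs amax smax) :
    Integrable (fun ξ : ℕ × (Fin N → ℕ) => (ξ.1 : ℝ)) S.noise :=
  (integrable_natCast_of_ae_le (h.ae_arrival_le le_rfl)).comp_fst _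

theorem IsParametrized.integrable_service (h : S.IsParametrized α σa σs amax smax) (i : Fin N) :
    Integrable (fun ξ : ℕ × (Fin N → ℕ) => (ξ.2 i : ℝ)) S.noise :=
  (integrable_comp_eval (μ := fun i => (S.service i).toMeasure)
    (integrable_natCast_of_ae_le (h.ae_service_le le_rfl i))).comp_snd _

theorem IsParametrized.integral_arrival (h : S.IsParametrized α σa σs amax smax) :
    ∫ ξ, (ξ.1 : ℝ) ∂S.noise = N * (1 - (N : ℝ) ^ (-α)) := by
  rw [← h.arrival_mean, noise, integral_fun_fst (fun n : ℕ => (n : ℝ))]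
  simp

theorem IsParametrized.integral_service (h : S.IsParametrized α σa σs amax smax) (i : Fin N) :
    ∫ ξ, (ξ.2 i : ℝ) ∂S.noise = 1 := by
  rw [← h.service_mean i, noise, integral_fun_snd (fun s : Fin N → ℕ => (s i : ℝ))]
  rw [integral_comp_eval (μ := fun i => (S.service i).toMeasure) (f := fun n : ℕ => (n : ℝ))
    Measurable.of_discrete.aestronglyMeasurable]
  simp

theorem IsParametrized.integrable_affine (h : S.IsParametrized α σa σs amax smax)
    (c₀ c₁ : ℝ) (d : Fin N → ℝ) :
    Integrable (fun ξ => c₀ + c₁ * (ξ.1 : ℝ) - ∑ j, d j * (ξ.2 j : ℝ)) S.noise :=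
  ((integrable_const _).add (h.integrable_arrival.const_mul _)).sub
    (integrable_finsetSum _ fun j _ => (h.integrable_service j).const_mul _)

theorem IsParametrized.integral_affine (h : S.IsParametrized α σa σs amax smax)
    (c₀ c₁ : ℝ) (d : Fin N → ℝ) :
    ∫ ξ, (c₀ + c₁ * (ξ.1 : ℝ) - ∑ j, d j * (ξ.2 j : ℝ)) ∂S.noise
      = c₀ + c₁ * (N * (1 - (N : ℝ) ^ (-α))) - ∑ j, d j := by
  have i1 : Integrable (fun ξ : ℕ × (Fin N → ℕ) => c₀ + c₁ * (ξ.1 : ℝ)) S.noise :=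
    (integrable_const _).add (h.integrable_arrival.const_mul _)
  rw [integral_sub i1
    (integrable_finsetSum _ fun j _ => (h.integrable_service j).const_mul _),
    integral_add (integrable_const _) (h.integrable_arrival.const_mul _),
    integral_finsetSum _ fun j _ => (h.integrable_service j).const_mul _,
    integral_const_mul, h.integral_arrival]
  simp [integral_const_mul, h.integral_service]

/-- The drift bounds use only a majorant affine in the noise, hence only first moments. The lower
integral needs no integrability of `f`. -/
theorem IsParametrized.lintegral_le_of_le_affine (h : S.IsParametrized α σa σs amax smax)
    (hM : max amax smax ≤ M) {f : ℕ × (Fin N → ℕ) → ℝ} (hf : ∀ ξ, 0 ≤ f ξ) {c₀ c₁ : ℝ}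
    {d : Fin N → ℝ} (hle : ∀ ξ : ℕ × (Fin N → ℕ), (ξ.1 : ℝ) ≤ M → (∀ i, (ξ.2 i : ℝ) ≤ M) →
      f ξ ≤ c₀ + c₁ * (ξ.1 : ℝ) - ∑ j, d j * (ξ.2 j : ℝ)) :
    ∫⁻ ξ, ENNReal.ofReal (f ξ) ∂S.noise
      ≤ ENNReal.ofReal (c₀ + c₁ * (N * (1 - (N : ℝ) ^ (-α))) - ∑ j, d j) := by
  have hae : ∀ᵐ ξ ∂S.noise, f ξ ≤ c₀ + c₁ * (ξ.1 : ℝ) - ∑ j, d j * (ξ.2 j : ℝ) := by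
    filter_upwards [h.ae_noise hM] with ξ hξ using hle ξ hξ.1 hξ.2
  rw [← h.integral_affine, ofReal_integral_eq_lintegral_ofReal (h.integrable_affine _ _ _)
    (by filter_upwards [hae] with ξ hξ using (hf ξ).trans hξ)]
  exact lintegral_mono_ae (by filter_upwards [hae] with ξ hξ using ENNReal.ofReal_le_ofReal hξ)

/-- The centered net input of one time slot. -/
def centeredInput (α : ℝ) (ξ : ℕ × (Fin N → ℕ)) : ℝ :=
  ((ξ.1 : ℝ) - N * (1 - (N : ℝ) ^ (-α))) - ∑ j, ((ξ.2 j : ℝ) - 1)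

theorem IsParametrized.integral_centeredInput (h : S.IsParametrized α σa σs amax smax) :
    ∫ ξ, centeredInput α ξ ∂S.noise = 0 := by
  have e : ∀ ξ : ℕ × (Fin N → ℕ), centeredInput α ξ
      = (N - N * (1 - (N : ℝ) ^ (-α))) + 1 * (ξ.1 : ℝ) - ∑ j, 1 * (ξ.2 j : ℝ) := fun ξ => by
    simp [centeredInput]; ring
  simp_rw [e]
  rw [h.integral_affine]
  simp

theorem IsParametrized.integrable_centeredInput (h : S.IsParametrized α σa σs amax smax) :
    Integrable (centeredInput α) S.noise := by
  have e : centeredInput α = fun ξ : ℕ × (Fin N → ℕ) =>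
      (N - N * (1 - (N : ℝ) ^ (-α))) + 1 * (ξ.1 : ℝ) - ∑ j, 1 * (ξ.2 j : ℝ) := by
    ext ξ; simp [centeredInput]; ring
  rw [e]
  exact h.integrable_affine _ _ _

theorem IsParametrized.abs_centeredInput_le (h : S.IsParametrized α σa σs amax smax)
    (hM : max amax smax ≤ M) (hM1 : 1 ≤ M) (hm : 0 ≤ N * (1 - (N : ℝ) ^ (-α))) :
    ∀ᵐ ξ ∂S.noise, |centeredInput α ξ| ≤ (N + 1) * M := by
  have hm' := h.arrival_mean_le hM
  filter_upwards [h.ae_noise hM] with ξ hξ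
  have h1 : |(ξ.1 : ℝ) - N * (1 - (N : ℝ) ^ (-α))| ≤ M := by
    rw [abs_le]; constructor <;> linarith [hξ.1, (Nat.cast_nonneg ξ.1 : (0 : ℝ) ≤ ξ.1)]
  have h2 : |∑ j, ((ξ.2 j : ℝ) - 1)| ≤ N * M := by
    refine (Finset.abs_sum_le_sum_abs _ _).trans ?_
    refine (Finset.sum_le_card_nsmul _ _ M fun j _ => ?_).trans (by simp)
    rw [abs_le]; constructor <;> linarith [hξ.2 j, (Nat.cast_nonneg (ξ.2 j) : (0 : ℝ) ≤ ξ.2 j)]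
  have := abs_sub ((ξ.1 : ℝ) - N * (1 - (N : ℝ) ^ (-α))) (∑ j, ((ξ.2 j : ℝ) - 1))
  rw [centeredInput]
  linarith

theorem IsParametrized.integrable_centeredInput_sq (h : S.IsParametrized α σa σs amax smax)
    (hM : max amax smax ≤ M) (hM1 : 1 ≤ M) (hm : 0 ≤ N * (1 - (N : ℝ) ^ (-α))) :
    Integrable (fun ξ => centeredInput α ξ ^ 2) S.noise := by
  refine Integrable.of_bound Measurable.of_discrete.aestronglyMeasurable (((N + 1) * M) ^ 2) ?_
  filter_upwards [h.abs_centeredInput_le hM hM1 hm] with ξ hξ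
  rw [norm_pow]
  exact pow_le_pow_left₀ (norm_nonneg _) hξ 2

/-- Independence makes the cross terms vanish, both between arrivals and services and among the
services. -/
theorem IsParametrized.integral_centeredInput_sq (h : S.IsParametrized α σa σs amax smax) :
    ∫ ξ, centeredInput α ξ ^ 2 ∂S.noise = N * (σa ^ 2 + σs ^ 2) := by
  set ν : Measure (Fin N → ℕ) := Measure.pi fun i => (S.service i).toMeasure with hν
  set A : ℕ → ℝ := fun n => (n : ℝ) - N * (1 - (N : ℝ) ^ (-α)) with hA
  set B : (Fin N → ℕ) → ℝ := fun s => ∑ j, ((s j : ℝ) - 1) with hB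
  have hLA : MemLp A 2 S.arrival.toMeasure :=
    (memLp_two_of_ae_le (h.ae_arrival_le le_rfl)).sub (memLp_const _)
  have hLs : ∀ j, MemLp (fun n : ℕ => (n : ℝ)) 2 (S.service j).toMeasure := fun j =>
    memLp_two_of_ae_le (h.ae_service_le le_rfl j)
  have hLs' : ∀ j, MemLp (fun s : Fin N → ℕ => (s j : ℝ)) 2 ν := fun j =>
    (hLs j).comp_measurePreserving (measurePreserving_eval _ j)
  have hLB : MemLp B 2 ν := memLp_finsetSum _ fun j _ => (hLs' j).sub (memLp_const _)
  have hmean : ∀ j, ∫ s, (s j : ℝ) ∂ν = 1 := fun j => by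
    rw [← h.service_mean j, hν, integral_comp_eval (μ := fun i => (S.service i).toMeasure)
      (f := fun n : ℕ => (n : ℝ)) Measurable.of_discrete.aestronglyMeasurable]
  have hA0 : ∫ n, A n ∂S.arrival.toMeasure = 0 := by
    rw [hA, integral_sub (integrable_natCast_of_ae_le (h.ae_arrival_le le_rfl))
      (integrable_const _), h.arrival_mean]
    simp
  have hA2 : ∫ n, A n ^ 2 ∂S.arrival.toMeasure = N * σa ^ 2 := by
    rw [← h.arrival_var, variance_eq_integral Measurable.of_discrete.aemeasurable, h.arrival_mean]
  have hB2 : ∫ s, B s ^ 2 ∂ν = N * σs ^ 2 := by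
    have hv := variance_sum_pi (μ := fun j => (S.service j).toMeasure) hLs
    rw [variance_eq_integral Measurable.of_discrete.aemeasurable] at hv
    simp only [h.service_var, Finset.sum_apply, Finset.sum_const, Finset.card_univ,
      Fintype.card_fin, nsmul_eq_mul] at hv
    rw [← hv]
    refine integral_congr_ae (ae_of_all _ fun s => ?_)
    simp only
    rw [integral_finsetSum _ fun j _ => (hLs' j).integrable one_le_two]
    simp [hB, hmean]
  have e : ∀ ξ : ℕ × (Fin N → ℕ), centeredInput α ξ ^ 2
      = A ξ.1 ^ 2 - 2 * (A ξ.1 * B ξ.2) + B ξ.2 ^ 2 := fun ξ => by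
    simp only [centeredInput, hA, hB]; ring
  have i1 : Integrable (fun ξ : ℕ × (Fin N → ℕ) => A ξ.1 ^ 2) S.noise :=
    hLA.integrable_sq.comp_fst _
  have i2 : Integrable (fun ξ : ℕ × (Fin N → ℕ) => 2 * (A ξ.1 * B ξ.2)) S.noise :=
    ((hLA.integrable one_le_two).mul_prod (hLB.integrable one_le_two)).const_mul 2
  have i3 : Integrable (fun ξ : ℕ × (Fin N → ℕ) => B ξ.2 ^ 2) S.noise :=
    hLB.integrable_sq.comp_snd _
  have i4 : Integrable (fun ξ : ℕ × (Fin N → ℕ) => A ξ.1 ^ 2 - 2 * (A ξ.1 * B ξ.2)) S.noise :=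
    i1.sub i2
  simp_rw [e]
  rw [integral_add i4 i3, integral_sub i1 i2, integral_const_mul, noise,
    integral_fun_fst (fun n => A n ^ 2), integral_fun_snd (fun s => B s ^ 2), integral_prod_mul, hA0,
    hA2, hB2]
  simp; ring

end Noise

end LoadBalancingSystem

/-! ### Exponential Lyapunov functions and their drift -/

theorem exp_le_one_add_add_sq {x b : ℝ} (hx : |x| ≤ b) (hb : b ≤ 1) :
    Real.exp x ≤ 1 + x + b ^ 2 := by
  have h := (abs_le.1 (Real.abs_exp_sub_one_sub_id_le (hx.trans hb))).2
  have h2 : x ^ 2 ≤ b ^ 2 := sq_le_sq' (by linarith [(abs_le.1 hx).1]) (abs_le.1 hx).2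
  linarith

namespace LoadBalancingSystem

variable {N : ℕ}

/-- An exponential Lyapunov function measuring how far the shortest queue is below the average. -/
def expSpread (θ : ℝ) (z : Fin N → ℝ) : ℝ := ∑ j, Real.exp (θ * ((∑ k, z k) / N - z j))

theorem expSpread_nonneg (θ : ℝ) (z : Fin N → ℝ) : 0 ≤ expSpread θ z :=
  Finset.sum_nonneg fun _ _ => (Real.exp_pos _).le

/-- Reflection raises by `u j` only those queues that end at zero, and these carry the largest
possible weight `top`. The tangent-line bound for `exp` at the reflected point gives a first-order
change `θ (top ∑ u - (∑ w) ∑ u / N)`, which is nonnegative because `∑ w ≤ N top`. -/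
theorem expSpread_max_zero_le [NeZero N] {θ : ℝ} (hθ : 0 ≤ θ) (z : Fin N → ℝ) :
    expSpread θ (fun j => max (z j) 0) ≤ expSpread θ z := by
  have hN : (0 : ℝ) < N := by exact_mod_cast NeZero.pos N
  set p : Fin N → ℝ := fun j => max (z j) 0 with hp
  set u : Fin N → ℝ := fun j => p j - z j with hu
  have hu0 : ∀ j, 0 ≤ u j := fun j => sub_nonneg.2 (le_max_left _ _)
  set w : Fin N → ℝ := fun j => Real.exp (θ * ((∑ k, p k) / N - p j)) with hw
  set top : ℝ := Real.exp (θ * ((∑ k, p k) / N)) with htop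
  have hwle : ∀ j, w j ≤ top := fun j => by
    have : 0 ≤ p j := le_max_right _ _
    simp only [hw, htop]
    gcongr; linarith
  have hwu : ∀ j, w j * u j = top * u j := fun j => by
    rcases le_total 0 (z j) with hz | hz
    · simp [hu, hp, hz]
    · simp [hw, htop, hp, hz]
  have hterm : ∀ j, w j + θ * (top * u j - w j * ((∑ k, u k) / N))
      ≤ Real.exp (θ * ((∑ k, z k) / N - z j)) := fun j => by
    have e : θ * ((∑ k, z k) / N - z j)
        = θ * ((∑ k, p k) / N - p j) + θ * (u j - (∑ k, u k) / N) := by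
      simp only [hu, Finset.sum_sub_distrib]; ring
    rw [e, Real.exp_add]
    calc w j + θ * (top * u j - w j * ((∑ k, u k) / N))
        = w j * (θ * (u j - (∑ k, u k) / N) + 1) := by rw [← hwu]; ring
      _ ≤ _ := mul_le_mul_of_nonneg_left (Real.add_one_le_exp _) (Real.exp_pos _).le
  have hsum := Finset.sum_le_sum fun j (_ : j ∈ Finset.univ) => hterm j
  rw [Finset.sum_add_distrib, ← Finset.mul_sum, Finset.sum_sub_distrib, ← Finset.mul_sum,
    ← Finset.sum_mul] at hsum
  have hW : ∑ j, w j ≤ N * top := by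
    refine (Finset.sum_le_card_nsmul _ _ top fun j _ => hwle j).trans (by simp)
  have hU : 0 ≤ (∑ k, u k) / N := div_nonneg (Finset.sum_nonneg fun k _ => hu0 k) hN.le
  have h1 : (∑ j, w j) * ((∑ k, u k) / N) ≤ top * ∑ k, u k := by
    calc (∑ j, w j) * ((∑ k, u k) / N) ≤ (N * top) * ((∑ k, u k) / N) := by gcongr
      _ = top * ∑ k, u k := by field_simp
  have h2 := mul_nonneg hθ (sub_nonneg.2 h1)
  change ∑ j, w j ≤ ∑ j, _
  linarith

/-- The real vector of queue lengths. -/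
def realQueues (q : Fin N → ℕ) : Fin N → ℝ := fun j => (q j : ℝ)

/-- The change of the queue lengths in one time slot, disregarding unused service. -/
def netInput (i : Fin N) (ξ : ℕ × (Fin N → ℕ)) (j : Fin N) : ℝ :=
  (if j = i then (ξ.1 : ℝ) else 0) - ξ.2 j

theorem realQueues_stepMap (q : Fin N → ℕ) (i : Fin N) (ξ : ℕ × (Fin N → ℕ)) (j : Fin N) :
    realQueues (stepMap ((q, i), ξ)) j = max (realQueues q j + netInput i ξ j) 0 := by
  have e : realQueues q j + netInput i ξ j
      = ((q j + if j = i then ξ.1 else 0 : ℕ) : ℝ) - (ξ.2 j : ℝ) := by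
    simp only [realQueues, netInput]; push_cast; ring
  rw [e]
  simp only [realQueues, stepMap, nextQueues]
  rcases le_total (ξ.2 j) (q j + if j = i then ξ.1 else 0) with h | h
  · rw [Nat.cast_sub h, max_eq_left]
    exact sub_nonneg.2 (by exact_mod_cast h)
  · rw [Nat.sub_eq_zero_of_le h, max_eq_right]
    · simp
    · exact sub_nonpos.2 (by exact_mod_cast h)

theorem abs_netInput_le {M : ℝ} (i : Fin N) {ξ : ℕ × (Fin N → ℕ)} (h1 : (ξ.1 : ℝ) ≤ M)
    (h2 : ∀ i, (ξ.2 i : ℝ) ≤ M) (j : Fin N) : |netInput i ξ j| ≤ M := by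
  have a := h2 j
  have b : (0 : ℝ) ≤ ξ.2 j := Nat.cast_nonneg _
  have c : (0 : ℝ) ≤ ξ.1 := Nat.cast_nonneg _
  rw [netInput, abs_le]
  split_ifs <;> constructor <;> linarith

theorem sum_netInput (i : Fin N) (ξ : ℕ × (Fin N → ℕ)) :
    ∑ j, netInput i ξ j = (ξ.1 : ℝ) - ∑ j, (ξ.2 j : ℝ) := by
  simp [netInput, Finset.sum_sub_distrib]

theorem exp_le_of_mem_shortestQueues {θ : ℝ} (hθ : 0 ≤ θ) {q : Fin N → ℕ} {i : Fin N}
    (hi : i ∈ shortestQueues q) (j : Fin N) :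
    Real.exp (θ * ((∑ k, realQueues q k) / N - realQueues q j))
      ≤ Real.exp (θ * ((∑ k, realQueues q k) / N - realQueues q i)) := by
  have : q i ≤ q j := by simpa [shortestQueues] using (Finset.mem_filter.1 hi).2 j
  have h : realQueues q i ≤ realQueues q j := by simp only [realQueues]; exact_mod_cast this
  gcongr

variable [NeZero N] {S : LoadBalancingSystem N} {α σa σs amax smax M δ : ℝ}

theorem natCast_pos_of_neZero : (0 : ℝ) < N := by exact_mod_cast NeZero.pos N

/-- Arrivals multiply the smallest of the `N` exponentials, so their contribution is at most `1 -
N^{-α}` times the sum, while the services remove the full sum to first order. Reflection costs at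
most one per server, which is the additive `N`. -/
theorem IsParametrized.lintegral_expSum_step_le (h : S.IsParametrized α σa σs amax smax)
    (hM : max amax smax ≤ M) (hε : 0 ≤ 1 - (N : ℝ) ^ (-α)) {η : ℝ} (hη : 0 ≤ η)
    (hηM : η * M ≤ 1) {q : Fin N → ℕ} {i : Fin N} (hi : i ∈ shortestQueues q) :
    ∫⁻ ξ, ENNReal.ofReal (∑ j, Real.exp (η * realQueues (stepMap ((q, i), ξ)) j)) ∂S.noise
      ≤ ENNReal.ofReal ((1 + (η * M) ^ 2 - η * (N : ℝ) ^ (-α)) *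
          ∑ j, Real.exp (η * realQueues q j) + N) := by
  have hN : (0 : ℝ) < N := natCast_pos_of_neZero
  set e : Fin N → ℝ := fun j => Real.exp (η * realQueues q j) with he
  have hpos : ∀ j, 0 < e j := fun j => Real.exp_pos _
  refine (h.lintegral_le_of_le_affine hM (fun ξ => Finset.sum_nonneg fun j _ => (Real.exp_pos _).le)
    (c₀ := N + (1 + (η * M) ^ 2) * ∑ j, e j) (c₁ := η * e i) (d := fun j => η * e j)
    fun ξ h1 h2 => ?_).trans (ENNReal.ofReal_le_ofReal ?_)
  · have hterm : ∀ j, Real.exp (η * realQueues (stepMap ((q, i), ξ)) j)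
        ≤ 1 + e j * (1 + η * netInput i ξ j + (η * M) ^ 2) := fun j => by
      rw [realQueues_stepMap]
      have hx : |η * netInput i ξ j| ≤ η * M := by
        rw [abs_mul, abs_of_nonneg hη]
        exact mul_le_mul_of_nonneg_left (abs_netInput_le i h1 h2 j) hη
      have h3 : Real.exp (η * (realQueues q j + netInput i ξ j))
          ≤ e j * (1 + η * netInput i ξ j + (η * M) ^ 2) := by
        rw [mul_add, Real.exp_add]
        exact mul_le_mul_of_nonneg_left (exp_le_one_add_add_sq hx hηM) (hpos j).le
      rcases le_total 0 (realQueues q j + netInput i ξ j) with h0 | h0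
      · rw [max_eq_left h0]; linarith
      · rw [max_eq_right h0, mul_zero, Real.exp_zero]
        linarith [(Real.exp_pos (η * (realQueues q j + netInput i ξ j))).le]
    refine (Finset.sum_le_sum fun j _ => hterm j).trans (le_of_eq ?_)
    have e1 : ∀ j, 1 + e j * (1 + η * netInput i ξ j + (η * M) ^ 2)
        = 1 + (1 + (η * M) ^ 2) * e j + (if j = i then η * e j * (ξ.1 : ℝ) else 0)
          - η * e j * (ξ.2 j : ℝ) := fun j => by
      simp only [netInput]; split_ifs <;> ring
    simp only [e1, Finset.sum_sub_distrib, Finset.sum_add_distrib, Finset.sum_ite_eq',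
      Finset.mem_univ, if_true, ← Finset.mul_sum]
    simp
  · have hmin : N * e i ≤ ∑ j, e j := by
      have := Finset.card_nsmul_le_sum Finset.univ e (e i) fun j _ => by
        have : q i ≤ q j := by simpa [shortestQueues] using (Finset.mem_filter.1 hi).2 j
        simp only [he, realQueues]
        gcongr
      simpa using this
    have h1 := mul_le_mul_of_nonneg_left hmin (mul_nonneg hη hε)
    rw [← Finset.mul_sum]
    linarith

theorem one_le_exp_of_mem_shortestQueues {θ : ℝ} (hθ : 0 ≤ θ) {q : Fin N → ℕ} {i : Fin N}
    (hi : i ∈ shortestQueues q) :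
    1 ≤ Real.exp (θ * ((∑ k, realQueues q k) / N - realQueues q i)) := by
  have hN : (0 : ℝ) < N := natCast_pos_of_neZero
  rw [Real.one_le_exp_iff]
  refine mul_nonneg hθ (sub_nonneg.2 ?_)
  rw [le_div_iff₀ hN]
  have := Finset.card_nsmul_le_sum Finset.univ (realQueues q) (realQueues q i) fun j _ => by
    have : q i ≤ q j := by simpa [shortestQueues] using (Finset.mem_filter.1 hi).2 j
    simp only [realQueues]
    exact_mod_cast this
  simpa [mul_comm] using this

/-- The queue lengths above average contribute little to the Lyapunov function. -/
theorem expSpread_le_of_mem_shortestQueues {θ : ℝ} (hθ : 0 ≤ θ) {q : Fin N → ℕ} {i : Fin N}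
    (hi : i ∈ shortestQueues q) :
    expSpread θ (realQueues q) ≤
      (N - 1) * Real.exp (θ * ((∑ k, realQueues q k) / N - realQueues q i)) + 1 := by
  have hN : (0 : ℝ) < N := natCast_pos_of_neZero
  obtain ⟨l, -, hl⟩ := Finset.exists_max_image Finset.univ (realQueues q) ⟨i, Finset.mem_univ i⟩
  have hl1 : Real.exp (θ * ((∑ k, realQueues q k) / N - realQueues q l)) ≤ 1 := by
    rw [Real.exp_le_one_iff]
    refine mul_nonpos_of_nonneg_of_nonpos hθ (sub_nonpos.2 ?_)
    rw [div_le_iff₀ hN]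
    have := Finset.sum_le_card_nsmul Finset.univ (realQueues q) (realQueues q l) hl
    simpa [mul_comm] using this
  rw [expSpread, ← Finset.sum_erase_add _ _ (Finset.mem_univ l)]
  refine add_le_add ?_ hl1
  refine (Finset.sum_le_card_nsmul _ _ _ fun j _ => exp_le_of_mem_shortestQueues hθ hi j).trans ?_
  rw [Finset.card_erase_of_mem (Finset.mem_univ l), nsmul_eq_mul, Finset.card_univ,
    Fintype.card_fin, Nat.cast_sub (NeZero.one_le)]
  simp

/-- The coefficients `F / N - w j` sum to zero, so services of equal mean cancel. Arrivals
contribute `-(1 - N^{-α}) (N w i - F)` with `w i` maximal. The longest queue has weight at most one,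
so `N w i - F ≥ w i - 1`, and `w i ≥ F / N` turns this into a contraction. The `2 * M` bounds the
change of a queue relative to the average. -/
theorem IsParametrized.lintegral_expSpread_step_le (h : S.IsParametrized α σa σs amax smax)
    (hM : max amax smax ≤ M) (hδ0 : 0 ≤ δ) (hδ : δ ≤ 1 - (N : ℝ) ^ (-α)) {θ : ℝ}
    (hθ : 0 ≤ θ) (hθM : θ * (2 * M) ≤ 1) {q : Fin N → ℕ} {i : Fin N} (hi : i ∈ shortestQueues q) :
    ∫⁻ ξ, ENNReal.ofReal (expSpread θ (realQueues (stepMap ((q, i), ξ)))) ∂S.noise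
      ≤ ENNReal.ofReal ((1 + (θ * (2 * M)) ^ 2 - θ * δ / N) * expSpread θ (realQueues q)
          + θ * δ) := by
  have hN : (0 : ℝ) < N := natCast_pos_of_neZero
  set w : Fin N → ℝ := fun j => Real.exp (θ * ((∑ k, realQueues q k) / N - realQueues q j)) with hw
  have hpos : ∀ j, 0 < w j := fun j => Real.exp_pos _
  have hF : expSpread θ (realQueues q) = ∑ j, w j := rfl
  rw [hF]
  set F : ℝ := ∑ j, w j with hFdef
  refine (h.lintegral_le_of_le_affine hM (fun ξ => expSpread_nonneg _ _)
    (c₀ := (1 + (θ * (2 * M)) ^ 2) * F) (c₁ := θ * (F / N - w i))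
    (d := fun j => θ * (F / N - w j))
    fun ξ h1 h2 => ?_).trans (ENNReal.ofReal_le_ofReal ?_)
  · have e0 : realQueues (stepMap ((q, i), ξ))
        = fun j => max (realQueues q j + netInput i ξ j) 0 := funext (realQueues_stepMap q i ξ)
    rw [e0]
    refine (expSpread_max_zero_le hθ _).trans ?_
    have hterm : ∀ j, Real.exp (θ * ((∑ k, (realQueues q k + netInput i ξ k)) / N
          - (realQueues q j + netInput i ξ j)))
        ≤ w j * (1 + θ * ((∑ k, netInput i ξ k) / N - netInput i ξ j)
          + (θ * (2 * M)) ^ 2) := fun j => by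
      have hx : |θ * ((∑ k, netInput i ξ k) / N - netInput i ξ j)| ≤ θ * (2 * M) := by
        rw [abs_mul, abs_of_nonneg hθ]
        refine mul_le_mul_of_nonneg_left ?_ hθ
        have ha : |(∑ k, netInput i ξ k) / N| ≤ M := by
          rw [abs_div, abs_of_pos hN, div_le_iff₀ hN]
          refine (Finset.abs_sum_le_sum_abs _ _).trans ?_
          refine (Finset.sum_le_card_nsmul _ _ M fun k _ => abs_netInput_le i h1 h2 k).trans ?_
          simp [mul_comm]
        have := abs_sub ((∑ k, netInput i ξ k) / N) (netInput i ξ j)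
        linarith [abs_netInput_le i h1 h2 j]
      have e1 : θ * ((∑ k, (realQueues q k + netInput i ξ k)) / N
          - (realQueues q j + netInput i ξ j))
          = θ * ((∑ k, realQueues q k) / N - realQueues q j)
            + θ * ((∑ k, netInput i ξ k) / N - netInput i ξ j) := by
        rw [Finset.sum_add_distrib]; ring
      rw [e1, Real.exp_add]
      exact mul_le_mul_of_nonneg_left (exp_le_one_add_add_sq hx hθM) (hpos j).le
    refine (Finset.sum_le_sum fun j _ => hterm j).trans (le_of_eq ?_)
    have e1 : ∀ j, w j * (1 + θ * ((∑ k, netInput i ξ k) / N - netInput i ξ j)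
          + (θ * (2 * M)) ^ 2)
        = (1 + (θ * (2 * M)) ^ 2 + θ * ((∑ k, netInput i ξ k) / N)) * w j
          - (if j = i then θ * w j * (ξ.1 : ℝ) else 0)
          + θ * (w j * (ξ.2 j : ℝ)) := fun j => by
      simp only [netInput]; split_ifs <;> ring
    have e2 : ∀ j, θ * (F / N - w j) * (ξ.2 j : ℝ)
        = θ * (F / N) * (ξ.2 j : ℝ) - θ * (w j * (ξ.2 j : ℝ)) := fun j => by ring
    rw [Finset.sum_congr rfl fun j _ => e1 j]
    simp only [e2, Finset.sum_sub_distrib, Finset.sum_add_distrib, Finset.sum_ite_eq',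
      Finset.mem_univ, if_true, ← Finset.mul_sum, sum_netInput]
    ring
  · have hd : ∑ j, θ * (F / N - w j) = 0 := by
      rw [← Finset.mul_sum, Finset.sum_sub_distrib]
      simp only [Finset.sum_const, Finset.card_univ, Fintype.card_fin, nsmul_eq_mul]
      rw [mul_div_cancel₀ _ hN.ne', ← hFdef]; simp
    rw [hd]
    have hFle : F ≤ (N - 1) * w i + 1 := expSpread_le_of_mem_shortestQueues hθ hi
    have hw1 : 1 ≤ w i := one_le_exp_of_mem_shortestQueues hθ hi
    have hFN : F ≤ N * w i := by linarith
    have h1 : (F / N - w i) * (N * (1 - (N : ℝ) ^ (-α))) ≤ δ - δ * (F / N) := by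
      have e : (F / N - w i) * (N * (1 - (N : ℝ) ^ (-α)))
          = -((N * w i - F) * (1 - (N : ℝ) ^ (-α))) := by field_simp; ring
      have h2 : δ * (w i - 1) ≤ (N * w i - F) * (1 - (N : ℝ) ^ (-α)) := by
        calc δ * (w i - 1) ≤ (1 - (N : ℝ) ^ (-α)) * (N * w i - F) :=
              mul_le_mul hδ (by linarith) (by linarith) (hδ0.trans hδ)
          _ = _ := by ring
      have h3 : F / N ≤ w i := by rw [div_le_iff₀ hN]; linarith
      have h4 := mul_le_mul_of_nonneg_left h3 hδ0
      linarith
    have h5 := mul_le_mul_of_nonneg_left h1 hθ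
    have e6 : θ * δ / N * F = θ * (δ * (F / N)) := by ring
    linarith

end LoadBalancingSystem

/-! ### Stationary exponential moments and state space collapse -/

namespace LoadBalancingSystem

variable {N : ℕ}

theorem norm_toLp_le_sum_abs (x : Fin N → ℝ) : ‖WithLp.toLp 2 x‖ ≤ ∑ j, |x j| := by
  rw [EuclideanSpace.norm_eq, Real.sqrt_le_left (Finset.sum_nonneg fun j _ => abs_nonneg _)]
  rw [sq, Finset.sum_mul]
  refine Finset.sum_le_sum fun j _ => ?_
  rw [Real.norm_eq_abs, sq]
  exact mul_le_mul_of_nonneg_left (Finset.single_le_sum (f := fun j => |x j|)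
    (fun j _ => abs_nonneg _) (Finset.mem_univ j)) (abs_nonneg _)

variable [NeZero N] {S : LoadBalancingSystem N} {α σa σs amax smax M δ : ℝ}
  {π : PMF (Fin N → ℕ)}

theorem integrable_and_integral_le_of_drift (hst : π.bind S.jsqStep = π) {W : (Fin N → ℕ) → ℝ}
    (hW : ∀ q, 0 ≤ W q) {γ K : ℝ} (hγ0 : 0 ≤ γ) (hγ : γ < 1) (hK : 0 ≤ K)
    (hdrift : ∀ q i, i ∈ shortestQueues q →
      ∫⁻ ξ, ENNReal.ofReal (W (stepMap ((q, i), ξ))) ∂S.noise ≤ ENNReal.ofReal (γ * W q + K)) :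
    Integrable W π.toMeasure ∧ ∫ q, W q ∂π.toMeasure ≤ K / (1 - γ) := by
  have h := lintegral_le_of_geometric_drift (ν := π.toMeasure) (ρ := dispatchLaw π) (μ := S.noise)
    (p := Prod.fst) (Φ := stepMap) (W := fun q => ENNReal.ofReal (W q)) (γ := ENNReal.ofReal γ)
    (K := ENNReal.ofReal K) measurable_fst Measurable.of_discrete (map_fst_dispatchLaw π)
    (map_stepMap_dispatchLaw hst) Measurable.of_discrete (fun _ => ENNReal.ofReal_ne_top)
    (by rw [← ENNReal.ofReal_one]; exact (ENNReal.ofReal_lt_ofReal_iff one_pos).2 hγ)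
    (by
      filter_upwards [ae_mem_shortestQueues π] with y hy
      rw [← ENNReal.ofReal_mul hγ0, ← ENNReal.ofReal_add (mul_nonneg hγ0 (hW _)) hK]
      exact hdrift y.1 y.2 hy)
  have e : ENNReal.ofReal K * (1 - ENNReal.ofReal γ)⁻¹ = ENNReal.ofReal (K / (1 - γ)) := by
    rw [← ENNReal.ofReal_one, ← ENNReal.ofReal_sub _ hγ0, ← ENNReal.ofReal_inv_of_pos (by linarith),
      ← ENNReal.ofReal_mul hK, div_eq_mul_inv]
  rw [e] at h
  have hint : Integrable W π.toMeasure := by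
    refine ⟨Measurable.of_discrete.aestronglyMeasurable, ?_⟩
    rw [hasFiniteIntegral_iff_ofReal (ae_of_all _ hW)]
    exact h.trans_lt ENNReal.ofReal_lt_top
  refine ⟨hint, ?_⟩
  rw [← ofReal_integral_eq_lintegral_ofReal hint (ae_of_all _ hW)] at h
  exact (ENNReal.ofReal_le_ofReal_iff (div_nonneg hK (by linarith))).1 h

/-- Only qualitative: it provides the finite second moment of the total queue length that Stein's
method needs. The exponent degenerates with `N^{-α}` and does not enter the final bound. -/
theorem IsParametrized.exists_integrable_expSum (h : S.IsParametrized α σa σs amax smax)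
    (hst : π.bind S.jsqStep = π) (hε : 0 ≤ 1 - (N : ℝ) ^ (-α)) :
    ∃ η : ℝ, 0 < η ∧
      Integrable (fun q => ∑ j, Real.exp (η * realQueues q j)) π.toMeasure := by
  have hN : (0 : ℝ) < N := natCast_pos_of_neZero
  set ε : ℝ := (N : ℝ) ^ (-α) with hεdef
  have hε0 : 0 < ε := Real.rpow_pos_of_pos hN _
  obtain ⟨M, hM⟩ : ∃ M, M = max amax smax := ⟨_, rfl⟩
  have hM1 : 1 ≤ M := h.one_le_smax.trans (hM ▸ le_max_right _ _)
  have hM0 : (0 : ℝ) < M := by linarith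
  -- With this `η` the second-order term `(η M)²` is half of the drift `η ε`.
  obtain ⟨η, hη⟩ : ∃ η, η = ε / (2 * M ^ 2) := ⟨_, rfl⟩
  have hη0 : 0 < η := hη ▸ by positivity
  have hηM : η * M ≤ 1 := by
    rw [hη, div_mul_eq_mul_div, div_le_one (by positivity)]
    nlinarith
  have e : (η * M) ^ 2 = η * ε / 2 := by rw [hη]; field_simp
  have hη1 : η ≤ 1 := (le_mul_of_one_le_right hη0.le hM1).trans hηM
  have hηε : η * ε ≤ 1 := mul_le_one₀ hη1 hε0.le (by linarith)
  have hηε0 : 0 < η * ε := mul_pos hη0 hε0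
  refine ⟨η, hη0, ?_⟩
  exact (integrable_and_integral_le_of_drift hst (γ := 1 + (η * M) ^ 2 - η * ε) (K := N)
    (W := fun q => ∑ j, Real.exp (η * realQueues q j)) (fun q => Finset.sum_nonneg fun j _ => (Real.exp_pos _).le) (by rw [e]; linarith)
    (by rw [e]; linarith) hN.le
    fun q i hi => h.lintegral_expSum_step_le hM.ge hε hη0.le hηM hi).1

/-- This `θ` makes the second-order term `(2 M θ)²` half of the contraction `θ δ / N`. The additive
term `θ δ` divided by the remaining rate `θ δ / (2 N)` is `2 N`. -/
theorem IsParametrized.expSpread_moment (h : S.IsParametrized α σa σs amax smax)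
    (hst : π.bind S.jsqStep = π) (hM : max amax smax ≤ M) (hδ0 : 0 < δ)
    (hδ : δ ≤ 1 - (N : ℝ) ^ (-α)) :
    Integrable (fun q => expSpread (δ / (8 * N * M ^ 2)) (realQueues q)) π.toMeasure ∧
      ∫ q, expSpread (δ / (8 * N * M ^ 2)) (realQueues q) ∂π.toMeasure ≤ 2 * N := by
  have hN : (0 : ℝ) < N := natCast_pos_of_neZero
  have hN1 : (1 : ℝ) ≤ N := by exact_mod_cast NeZero.one_le
  have hε0 : 0 < (N : ℝ) ^ (-α) := Real.rpow_pos_of_pos hN _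
  have hδ1 : δ ≤ 1 := by linarith
  have hM1 : 1 ≤ M := h.one_le_smax.trans ((le_max_right _ _).trans hM)
  have hM0 : (0 : ℝ) < M := by linarith
  set θ : ℝ := δ / (8 * N * M ^ 2) with hθ
  have hθ0 : 0 < θ := by positivity
  have hNM : 1 ≤ N * M := by nlinarith
  have hθM : θ * (2 * M) ≤ 1 := by
    rw [hθ, div_mul_eq_mul_div, div_le_one (by positivity)]
    nlinarith
  have hθ1 : θ ≤ 1 := by nlinarith
  have e : (θ * (2 * M)) ^ 2 = θ * δ / N / 2 := by rw [hθ]; field_simp; ring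
  have hx : θ * δ / N ≤ 1 := by
    rw [div_le_one hN]; nlinarith
  have hx0 : 0 < θ * δ / N := by positivity
  have key := integrable_and_integral_le_of_drift hst
    (γ := 1 + (θ * (2 * M)) ^ 2 - θ * δ / N) (K := θ * δ)
    (W := fun q => expSpread θ (realQueues q)) (fun q => expSpread_nonneg _ _) (by rw [e]; linarith)
    (by rw [e]; linarith) (by positivity)
    fun q i hi => h.lintegral_expSpread_step_le hM hδ0.le hδ hθ0.le hθM hi
  refine ⟨key.1, key.2.trans (le_of_eq ?_)⟩
  have e2 : 1 - (1 + (θ * (2 * M)) ^ 2 - θ * δ / N) = θ * δ / (2 * N) := by rw [e]; ring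
  rw [e2, div_div_eq_mul_div, mul_div_assoc, mul_comm, div_mul_cancel₀ _ (by positivity)]

/-- The deviations from the average sum to zero, so their `ℓ¹` norm, and with it the Euclidean norm,
is at most `2 N` times the depth of the shortest queue below the average. -/
theorem exp_norm_perp_le {θ : ℝ} (hθ : 0 ≤ θ) (q : Fin N → ℕ) :
    Real.exp (θ / (2 * N) * ‖perp q‖) ≤ expSpread θ (realQueues q) := by
  have hN : (0 : ℝ) < N := natCast_pos_of_neZero
  obtain ⟨i, hi⟩ := shortestQueues_nonempty q
  have hmin : ∀ j, realQueues q i ≤ realQueues q j := fun j => by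
    have : q i ≤ q j := by simpa [shortestQueues] using (Finset.mem_filter.1 hi).2 j
    simp only [realQueues]; exact_mod_cast this
  set m : ℝ := (∑ k, realQueues q k) / N with hm
  have hsum : ∑ j, (realQueues q j - m) = 0 := by
    rw [Finset.sum_sub_distrib]
    simp only [Finset.sum_const, Finset.card_univ, Fintype.card_fin, nsmul_eq_mul]
    rw [hm, mul_div_cancel₀ _ hN.ne']; simp
  have hmi : realQueues q i ≤ m := by
    rw [hm, le_div_iff₀ hN]
    have := Finset.card_nsmul_le_sum Finset.univ (realQueues q) (realQueues q i) fun j _ => hmin j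
    simpa [mul_comm] using this
  have hnorm : ‖perp q‖ ≤ 2 * N * (m - realQueues q i) := by
    refine (norm_toLp_le_sum_abs _).trans ?_
    have h1 : ∀ j, |realQueues q j - m|
        ≤ (realQueues q j - m) + 2 * (m - realQueues q i) := fun j => by
      rw [abs_le]
      constructor <;> linarith [hmin j]
    refine (Finset.sum_le_sum fun j _ => h1 j).trans (le_of_eq ?_)
    rw [Finset.sum_add_distrib, hsum]
    simp; ring
  have h2 : θ / (2 * N) * ‖perp q‖ ≤ θ * (m - realQueues q i) := by
    calc θ / (2 * N) * ‖perp q‖ ≤ θ / (2 * N) * (2 * N * (m - realQueues q i)) := by gcongr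
      _ = _ := by field_simp
  refine (Real.exp_le_exp.2 h2).trans ?_
  exact Finset.single_le_sum (f := fun j => Real.exp (θ * (m - realQueues q j)))
    (fun j _ => (Real.exp_pos _).le) (Finset.mem_univ i)

theorem IsParametrized.stateSpaceCollapse (h : S.IsParametrized α σa σs amax smax)
    (hst : π.bind S.jsqStep = π) (hM : max amax smax ≤ M) (hδ0 : 0 < δ)
    (hδ : δ ≤ 1 - (N : ℝ) ^ (-α)) {C : ℝ} (hC : 32 * N ^ 2 * M ^ 2 / δ ≤ C) :
    StateSpaceCollapse π C := by
  intro r hr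
  have hN : (0 : ℝ) < N := natCast_pos_of_neZero
  have hN1 : (1 : ℝ) ≤ N := by exact_mod_cast NeZero.one_le
  have hM1 : 1 ≤ M := h.one_le_smax.trans ((le_max_right _ _).trans hM)
  have hM0 : (0 : ℝ) < M := by linarith
  obtain ⟨hint, hle⟩ := h.expSpread_moment hst hM hδ0 hδ
  set θ : ℝ := δ / (8 * N * M ^ 2) with hθ
  have hθ0 : 0 < θ := by positivity
  have hpt : ∀ q : Fin N → ℕ, ‖perp q‖ ^ r
      ≤ (r.factorial * (2 * N / θ) ^ r) * expSpread θ (realQueues q) := fun q => by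
    have h1 := Real.pow_div_factorial_le_exp (x := θ / (2 * N) * ‖perp q‖) (by positivity) r
    have h2 := h1.trans (exp_norm_perp_le hθ0.le q)
    rw [div_le_iff₀ (by positivity)] at h2
    calc ‖perp q‖ ^ r = (2 * N / θ) ^ r * (θ / (2 * N) * ‖perp q‖) ^ r := by
          rw [← mul_pow]; congr 1; field_simp
      _ ≤ (2 * N / θ) ^ r * (expSpread θ (realQueues q) * r.factorial) := by gcongr
      _ = _ := by ring
  have hI : Integrable (fun q => ‖perp q‖ ^ r) π.toMeasure := by
    refine Integrable.mono' (hint.const_mul (r.factorial * (2 * N / θ) ^ r))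
      Measurable.of_discrete.aestronglyMeasurable (ae_of_all _ fun q => ?_)
    rw [Real.norm_of_nonneg (by positivity)]
    exact hpt q
  refine ⟨hI, ?_⟩
  -- The prefactor `2 N` from the exponential moment is absorbed into the `r`-th power, which uses
  -- `r ≥ 1`.
  have hpow : (2 * N / θ) ^ r * (2 * N) ≤ (C * N) ^ r := by
    calc (2 * N / θ) ^ r * (2 * N) ≤ (2 * N / θ) ^ r * (2 * N) ^ r := by
          gcongr
          exact le_self_pow₀ (by linarith) (by omega)
      _ = (32 * N ^ 2 * M ^ 2 / δ * N) ^ r := by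
          rw [← mul_pow]; congr 1; rw [hθ]; field_simp; ring
      _ ≤ _ := by gcongr
  have hC0 : 0 ≤ C := le_trans (by positivity) hC
  calc ∫ q, ‖perp q‖ ^ r ∂π.toMeasure
      ≤ ∫ q, (r.factorial * (2 * N / θ) ^ r) * expSpread θ (realQueues q) ∂π.toMeasure :=
        integral_mono hI (hint.const_mul _) hpt
    _ = (r.factorial * (2 * N / θ) ^ r) * ∫ q, expSpread θ (realQueues q) ∂π.toMeasure :=
        integral_const_mul _ _
    _ ≤ (r.factorial * (2 * N / θ) ^ r) * (2 * N) := by gcongr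
    _ = r.factorial * ((2 * N / θ) ^ r * (2 * N)) := by ring
    _ ≤ ((r : ℝ) ^ ((r : ℝ) + 1 / 2) * Real.exp (1 - r)) * (C * N) ^ r := by
        gcongr
        exact factorial_le_rpow_mul_exp hr
    _ = _ := by rw [mul_pow]; ring

end LoadBalancingSystem

/-! ### One Stein step for a reflected walk -/

theorem lipschitzWith_expSteinSolution {h : ℝ → ℝ} (hh : LipschitzWith 1 h) :
    LipschitzWith 1 (expSteinSolution h) :=
  LipschitzWith.of_dist_le_mul fun x y => by
    simpa [Real.dist_eq] using abs_expSteinSolution_sub_le hh x y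

theorem lipschitzWith_expSteinDeriv {h : ℝ → ℝ} (hh : LipschitzWith 1 h) :
    LipschitzWith 2 (expSteinDeriv h) :=
  LipschitzWith.of_dist_le_mul fun x y => by
    simpa [Real.dist_eq] using abs_expSteinDeriv_sub_le hh x y

theorem abs_expSteinSolution_le {h : ℝ → ℝ} (hh : LipschitzWith 1 h) (x : ℝ) :
    |expSteinSolution h x| ≤ |x| := by
  simpa [expSteinSolution_zero] using abs_expSteinSolution_sub_le hh x 0

theorem abs_expSteinPrimitive_le {h : ℝ → ℝ} (hh : LipschitzWith 1 h) (x : ℝ) :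
    |expSteinPrimitive h x| ≤ x ^ 2 := by
  simpa [expSteinSolution_zero, expSteinPrimitive] using abs_expSteinPrimitive_add_sub_le hh 0 x

/-- One step of Stein's method for a reflected random walk with small increments: `y` is the
reflection term, `d` the centered increment and `b` the drift. -/
theorem abs_expSteinPrimitive_increment_le {h : ℝ → ℝ} (hh : LipschitzWith 1 h) (x b d y : ℝ) :
    |expSteinPrimitive h (x - b + d + y) - expSteinPrimitive h x - d * expSteinSolution h (x - b)
        - (d ^ 2 / 2 - b) * expSteinDeriv h (x - b)
        - b * (h x - ∫ s, h s ∂(expMeasure 1))|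
      ≤ y ^ 2 + |y| * |x - b + d + y| + 2 * |d| ^ 3 + 3 * b ^ 2 := by
  -- The reflection is expanded backwards from the new state. Since the Stein solution vanishes at
  -- zero, its first-order cost is at most `|y|` times the size of the new state, which is small
  -- when reflection occurs near the origin.
  have h1 := abs_expSteinPrimitive_add_sub_le hh (x - b + d + y) (-y)
  rw [show x - b + d + y + -y = x - b + d by ring, neg_sq] at h1
  have h2 := abs_expSteinPrimitive_taylor_le hh (x - b) d
  have h3 := abs_expSteinPrimitive_add_sub_le hh x (-b)
  rw [show x + -b = x - b by ring, neg_sq] at h3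
  have h4 := abs_expSteinDeriv_sub_le hh (x - b) x
  rw [show x - b - x = -b by ring, abs_neg] at h4
  have h5 : |y * expSteinSolution h (x - b + d + y)| ≤ |y| * |x - b + d + y| := by
    rw [abs_mul]
    exact mul_le_mul_of_nonneg_left (abs_expSteinSolution_le hh _) (abs_nonneg _)
  have h6 : |b * (expSteinDeriv h (x - b) - expSteinDeriv h x)| ≤ 2 * b ^ 2 := by
    rw [abs_mul]
    calc |b| * _ ≤ |b| * (2 * |b|) := mul_le_mul_of_nonneg_left h4 (abs_nonneg _)
      _ = 2 * b ^ 2 := by rw [← sq_abs b]; ring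
  have h7 : expSteinDeriv h x = expSteinSolution h x + h x - ∫ s, h s ∂(expMeasure 1) := rfl
  have h8 : b * (h x - ∫ s, h s ∂(expMeasure 1))
      = b * expSteinDeriv h x - b * expSteinSolution h x := by rw [h7]; ring
  rw [h8]
  rw [abs_le] at *
  constructor <;> linarith [h1.1, h1.2, h2.1, h2.2, h3.1, h3.2, h5.1, h5.2, h6.1, h6.2]

/-! ### Unused service -/

namespace LoadBalancingSystem

variable {N : ℕ}

/-- The total queue length. -/
def total (q : Fin N → ℕ) : ℝ := ∑ j, realQueues q j

/-- The total unused service of one time slot. -/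
def unused (z : ((Fin N → ℕ) × Fin N) × (ℕ × (Fin N → ℕ))) : ℝ :=
  total (stepMap z) - total z.1.1 - ((z.2.1 : ℝ) - ∑ j, (z.2.2 j : ℝ))

theorem unused_eq_sum (z : ((Fin N → ℕ) × Fin N) × (ℕ × (Fin N → ℕ))) :
    unused z = ∑ j, (realQueues (stepMap z) j - (realQueues z.1.1 j + netInput z.1.2 z.2 j)) := by
  rw [Finset.sum_sub_distrib, Finset.sum_add_distrib, sum_netInput, unused, total, total]
  ring

theorem unused_eq_sub_centeredInput (α : ℝ) (z : ((Fin N → ℕ) × Fin N) × (ℕ × (Fin N → ℕ))) :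
    unused z = total (stepMap z) - total z.1.1 - centeredInput α z.2 + N * (N : ℝ) ^ (-α) := by
  simp only [unused, centeredInput, Finset.sum_sub_distrib]
  simp
  ring

theorem unused_nonneg (z : ((Fin N → ℕ) × Fin N) × (ℕ × (Fin N → ℕ))) : 0 ≤ unused z := by
  rw [unused_eq_sum]
  refine Finset.sum_nonneg fun j _ => ?_
  rw [realQueues_stepMap z.1.1 z.1.2 z.2 j]
  exact sub_nonneg.2 (le_max_left _ _)

theorem unused_le {M : ℝ} {z : ((Fin N → ℕ) × Fin N) × (ℕ × (Fin N → ℕ))} (hM0 : 0 ≤ M)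
    (hz : ∀ i, (z.2.2 i : ℝ) ≤ M) : unused z ≤ N * M := by
  rw [unused_eq_sum]
  refine (Finset.sum_le_card_nsmul _ _ M fun j _ => ?_).trans (by simp)
  have hstep : realQueues (stepMap z) j = max (realQueues z.1.1 j + netInput z.1.2 z.2 j) 0 :=
    realQueues_stepMap z.1.1 z.1.2 z.2 j
  have hq : 0 ≤ realQueues z.1.1 j := Nat.cast_nonneg _
  have hn : -M ≤ netInput z.1.2 z.2 j := by
    have a := hz j
    have c : (0 : ℝ) ≤ z.2.1 := Nat.cast_nonneg _
    rw [netInput]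
    split_ifs <;> linarith
  rw [hstep]
  rcases le_total 0 (realQueues z.1.1 j + netInput z.1.2 z.2 j) with h0 | h0
  · rw [max_eq_left h0]; linarith
  · rw [max_eq_right h0]; linarith

theorem exists_eq_zero_of_unused_ne_zero {z : ((Fin N → ℕ) × Fin N) × (ℕ × (Fin N → ℕ))}
    (hz : unused z ≠ 0) : ∃ j, realQueues (stepMap z) j = 0 := by
  by_contra! hne
  refine hz ?_
  rw [unused_eq_sum]
  refine Finset.sum_eq_zero fun j _ => ?_
  have hstep : realQueues (stepMap z) j = max (realQueues z.1.1 j + netInput z.1.2 z.2 j) 0 :=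
    realQueues_stepMap z.1.1 z.1.2 z.2 j
  have := hne j
  rw [hstep] at this ⊢
  rcases le_total 0 (realQueues z.1.1 j + netInput z.1.2 z.2 j) with h0 | h0
  · rw [max_eq_left h0, sub_self]
  · exact absurd (max_eq_right h0) this

variable [NeZero N] {S : LoadBalancingSystem N} {α σa σs amax smax M δ : ℝ}
  {π : PMF (Fin N → ℕ)}

section Integrability

theorem integrable_comp_dispatch {φ : (Fin N → ℕ) → ℝ} (hφ : Integrable φ π.toMeasure) :
    Integrable (fun y : (Fin N → ℕ) × Fin N => φ y.1) (dispatchLaw π) := by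
  rw [← map_fst_dispatchLaw π] at hφ
  exact (integrable_map_measure Measurable.of_discrete.aestronglyMeasurable
    measurable_fst.aemeasurable).1 hφ

theorem integral_comp_dispatch (φ : (Fin N → ℕ) → ℝ) :
    ∫ y, φ y.1 ∂(dispatchLaw π) = ∫ q, φ q ∂π.toMeasure := by
  rw [← map_fst_dispatchLaw π, integral_map measurable_fst.aemeasurable
    Measurable.of_discrete.aestronglyMeasurable]

theorem integrable_comp_current (S : LoadBalancingSystem N) {φ : (Fin N → ℕ) → ℝ}
    (hφ : Integrable φ π.toMeasure) :
    Integrable (fun z => φ z.1.1) ((dispatchLaw π).prod S.noise) :=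
  (integrable_comp_dispatch hφ).comp_fst _

theorem integral_comp_current (S : LoadBalancingSystem N) (φ : (Fin N → ℕ) → ℝ) :
    ∫ z, φ z.1.1 ∂((dispatchLaw π).prod S.noise) = ∫ q, φ q ∂π.toMeasure := by
  rw [integral_fun_fst (fun y : (Fin N → ℕ) × Fin N => φ y.1), integral_comp_dispatch]
  simp

theorem integrable_comp_stepMap (hst : π.bind S.jsqStep = π) {φ : (Fin N → ℕ) → ℝ}
    (hφ : Integrable φ π.toMeasure) :
    Integrable (fun z => φ (stepMap z)) ((dispatchLaw π).prod S.noise) := by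
  rw [← map_stepMap_dispatchLaw hst] at hφ
  exact (integrable_map_measure Measurable.of_discrete.aestronglyMeasurable
    Measurable.of_discrete.aemeasurable).1 hφ

theorem integral_comp_stepMap (hst : π.bind S.jsqStep = π) (φ : (Fin N → ℕ) → ℝ) :
    ∫ z, φ (stepMap z) ∂((dispatchLaw π).prod S.noise) = ∫ q, φ q ∂π.toMeasure := by
  conv_rhs => rw [← map_stepMap_dispatchLaw hst]
  rw [integral_map Measurable.of_discrete.aemeasurable
    Measurable.of_discrete.aestronglyMeasurable]

theorem IsParametrized.integrable_total_sq (h : S.IsParametrized α σa σs amax smax)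
    (hst : π.bind S.jsqStep = π) (hε : 0 ≤ 1 - (N : ℝ) ^ (-α)) :
    Integrable (fun q => total q ^ 2) π.toMeasure := by
  obtain ⟨η, hη, hint⟩ := h.exists_integrable_expSum hst hε
  refine Integrable.mono' (hint.const_mul (N * (2 / η ^ 2)))
    Measurable.of_discrete.aestronglyMeasurable (ae_of_all _ fun q => ?_)
  rw [Real.norm_of_nonneg (sq_nonneg _)]
  have h1 : ∀ j, realQueues q j ^ 2 ≤ 2 / η ^ 2 * Real.exp (η * realQueues q j) := fun j => by
    have := Real.pow_div_factorial_le_exp (x := η * realQueues q j)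
      (mul_nonneg hη.le (Nat.cast_nonneg _)) 2
    rw [mul_pow, Nat.factorial_two] at this
    push_cast at this
    rw [div_mul_eq_mul_div, le_div_iff₀ (by positivity)]
    linarith
  calc total q ^ 2 ≤ N * ∑ j, realQueues q j ^ 2 := by
        simpa [total] using sq_sum_le_card_mul_sum_sq (s := Finset.univ) (f := realQueues q)
    _ ≤ N * ∑ j, 2 / η ^ 2 * Real.exp (η * realQueues q j) := by
        gcongr with j; exact h1 j
    _ = _ := by rw [← Finset.mul_sum]; ring

theorem IsParametrized.integrable_total (h : S.IsParametrized α σa σs amax smax)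
    (hst : π.bind S.jsqStep = π) (hε : 0 ≤ 1 - (N : ℝ) ^ (-α)) :
    Integrable (total (N := N)) π.toMeasure :=
  ((memLp_two_iff_integrable_sq Measurable.of_discrete.aestronglyMeasurable).2
    (h.integrable_total_sq hst hε)).integrable one_le_two

end Integrability

section Unused

/-- Service is unused only if some queue is empty, and then the total queue length is controlled by
the spread of the queue lengths. -/
theorem unused_mul_total_le {θ ℓ : ℝ} (hθ : 0 < θ) (hℓ : 0 ≤ ℓ) (hM0 : 0 ≤ M)
    {z : ((Fin N → ℕ) × Fin N) × (ℕ × (Fin N → ℕ))} (hz : ∀ i, (z.2.2 i : ℝ) ≤ M) :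
    unused z * total (stepMap z) ≤ N / θ * (ℓ * unused z +
      N * M * Real.exp (-ℓ) * expSpread θ (realQueues (stepMap z))) := by
  have hN : (0 : ℝ) < N := natCast_pos_of_neZero
  have hU := unused_nonneg z
  set F := expSpread θ (realQueues (stepMap z)) with hF
  have hF0 : 0 ≤ F := expSpread_nonneg _ _
  by_cases h0 : unused z = 0
  · rw [h0]
    have : 0 ≤ N / θ * (ℓ * 0 + N * M * Real.exp (-ℓ) * F) := by positivity
    simpa using this
  obtain ⟨j, hj⟩ := exists_eq_zero_of_unused_ne_zero h0
  have h1 : Real.exp (θ * (total (stepMap z) / N)) ≤ F := by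
    have := Finset.single_le_sum (f := fun j => Real.exp (θ * ((∑ k, realQueues (stepMap z) k) / N -
      realQueues (stepMap z) j))) (fun j _ => (Real.exp_pos _).le) (Finset.mem_univ j)
    simp only [hj, sub_zero] at this
    exact this
  -- The inequality `t ≤ ℓ + exp (t - ℓ)` trades an exponential moment for a level `ℓ`, at a cost
  -- carrying the factor `exp (-ℓ)`.
  have h2 : θ * (total (stepMap z) / N) ≤ ℓ + Real.exp (-ℓ) * F := by
    have := Real.add_one_le_exp (θ * (total (stepMap z) / N) - ℓ)
    have h3 : Real.exp (θ * (total (stepMap z) / N) - ℓ) ≤ Real.exp (-ℓ) * F := by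
      rw [sub_eq_neg_add, Real.exp_add]; gcongr
    linarith
  have h4 : unused z * (Real.exp (-ℓ) * F) ≤ N * M * (Real.exp (-ℓ) * F) :=
    mul_le_mul_of_nonneg_right (unused_le hM0 hz) (by positivity)
  calc unused z * total (stepMap z)
      = N / θ * (unused z * (θ * (total (stepMap z) / N))) := by field_simp
    _ ≤ N / θ * (unused z * (ℓ + Real.exp (-ℓ) * F)) := by gcongr
    _ = N / θ * (ℓ * unused z + unused z * (Real.exp (-ℓ) * F)) := by ring
    _ ≤ N / θ * (ℓ * unused z + N * M * (Real.exp (-ℓ) * F)) := by gcongr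
    _ = _ := by ring

theorem IsParametrized.integrable_unused (h : S.IsParametrized α σa σs amax smax)
    (hst : π.bind S.jsqStep = π) (hε : 0 ≤ 1 - (N : ℝ) ^ (-α)) :
    Integrable (unused (N := N)) ((dispatchLaw π).prod S.noise) := by
  have hT := h.integrable_total hst hε
  have e : unused (N := N) = fun z => total (stepMap z) - total z.1.1 - centeredInput α z.2
      + N * (N : ℝ) ^ (-α) := funext (unused_eq_sub_centeredInput α)
  rw [e]
  exact (((integrable_comp_stepMap hst hT).sub (integrable_comp_current S hT)).sub
    (h.integrable_centeredInput.comp_snd _)).add (integrable_const _)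

/-- In steady state the mean total does not change, so unused service must balance the gap between
mean service `N` and mean arrivals. -/
theorem IsParametrized.integral_unused (h : S.IsParametrized α σa σs amax smax)
    (hst : π.bind S.jsqStep = π) (hε : 0 ≤ 1 - (N : ℝ) ^ (-α)) :
    ∫ z, unused z ∂((dispatchLaw π).prod S.noise) = N * (N : ℝ) ^ (-α) := by
  have hT := h.integrable_total hst hε
  have i1 := integrable_comp_stepMap hst hT
  have i2 := integrable_comp_current S hT
  have i3 : Integrable (fun z : ((Fin N → ℕ) × Fin N) × (ℕ × (Fin N → ℕ)) => centeredInput α z.2)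
    ((dispatchLaw π).prod S.noise) := h.integrable_centeredInput.comp_snd _
  have i4 : Integrable (fun z => total (stepMap z) - total z.1.1) ((dispatchLaw π).prod S.noise) :=
    i1.sub i2
  have i5 : Integrable (fun z => total (stepMap z) - total z.1.1 - centeredInput α z.2)
    ((dispatchLaw π).prod S.noise) := i4.sub i3
  simp_rw [unused_eq_sub_centeredInput α]
  rw [integral_add i5 (integrable_const _), integral_sub i4 i3, integral_sub i1 i2,
    integral_comp_stepMap hst, integral_comp_current,
    integral_fun_snd (fun ξ : ℕ × (Fin N → ℕ) => centeredInput α ξ), h.integral_centeredInput]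
  simp

end Unused

end LoadBalancingSystem

/-! ### The Wasserstein estimate -/

namespace LoadBalancingSystem

variable {N : ℕ} [NeZero N] {S : LoadBalancingSystem N} {α σa σs amax smax M δ : ℝ}
  {π : PMF (Fin N → ℕ)}

theorem IsParametrized.integral_unused_mul_total_le (h : S.IsParametrized α σa σs amax smax)
    (hst : π.bind S.jsqStep = π) (hM : max amax smax ≤ M) (hδ0 : 0 < δ)
    (hδ : δ ≤ 1 - (N : ℝ) ^ (-α)) (hα : 0 ≤ α) :
    ∃ R : ((Fin N → ℕ) × Fin N) × (ℕ × (Fin N → ℕ)) → ℝ,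
      Integrable R ((dispatchLaw π).prod S.noise) ∧
      (∀ᵐ z ∂((dispatchLaw π).prod S.noise), unused z * total (stepMap z) ≤ R z) ∧
      ∫ z, R z ∂((dispatchLaw π).prod S.noise) ≤
        8 * N ^ 2 * M ^ 2 / δ * (N * (N : ℝ) ^ (-α)) * (α * Real.log N + 2 * N * M) := by
  have hN : (0 : ℝ) < N := natCast_pos_of_neZero
  have hM1 : 1 ≤ M := h.one_le_smax.trans ((le_max_right _ _).trans hM)
  have hM0 : (0 : ℝ) < M := by linarith
  have hε : 0 ≤ 1 - (N : ℝ) ^ (-α) := hδ0.le.trans hδ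
  have hε0 : 0 < (N : ℝ) ^ (-α) := Real.rpow_pos_of_pos hN _
  obtain ⟨hint, hle⟩ := h.expSpread_moment hst hM hδ0 hδ
  set θ : ℝ := δ / (8 * N * M ^ 2) with hθ
  have hθ0 : 0 < θ := by positivity
  -- This level gives `exp (-ℓ) = N^{-α}`, so both terms of the majorant have the order of the mean
  -- unused service, up to the logarithm and powers of `N`.
  set ℓ : ℝ := α * Real.log N with hℓ
  have hℓ0 : 0 ≤ ℓ := mul_nonneg hα (Real.log_natCast_nonneg N)
  have hexp : Real.exp (-ℓ) = (N : ℝ) ^ (-α) := by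
    rw [Real.rpow_def_of_pos hN]; congr 1; rw [hℓ]; ring
  have i1 := (h.integrable_unused hst hε).const_mul ℓ
  have i2 := (integrable_comp_stepMap hst hint).const_mul (N * M * Real.exp (-ℓ))
  refine ⟨fun z => N / θ * (ℓ * unused z +
      N * M * Real.exp (-ℓ) * expSpread θ (realQueues (stepMap z))), (i1.add i2).const_mul _, ?_, ?_⟩
  · filter_upwards [Measure.quasiMeasurePreserving_snd.ae (h.ae_noise hM)] with z hz
    exact unused_mul_total_le hθ0 hℓ0 hM0.le hz.2
  · rw [integral_const_mul, integral_add i1 i2, integral_const_mul, integral_const_mul,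
      h.integral_unused hst hε, integral_comp_stepMap hst
        (fun q => expSpread θ (realQueues q)), hexp]
    have hNθ : (N : ℝ) / θ = 8 * N ^ 2 * M ^ 2 / δ := by rw [hθ]; field_simp
    rw [hNθ]
    calc 8 * (N : ℝ) ^ 2 * M ^ 2 / δ * (ℓ * (N * (N : ℝ) ^ (-α)) + N * M * (N : ℝ) ^ (-α) *
          ∫ q, expSpread θ (realQueues q) ∂π.toMeasure)
        ≤ 8 * (N : ℝ) ^ 2 * M ^ 2 / δ * (ℓ * (N * (N : ℝ) ^ (-α)) + N * M * (N : ℝ) ^ (-α) *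
          (2 * N)) := by gcongr
      _ = _ := by ring

/-- Exponential approximation of the scaled total queue length against a Lipschitz test function. -/
theorem IsParametrized.abs_integral_scaledTotal_sub_le (h : S.IsParametrized α σa σs amax smax)
    (hst : π.bind S.jsqStep = π) (hM : max amax smax ≤ M) (hδ0 : 0 < δ)
    (hδ : δ ≤ 1 - (N : ℝ) ^ (-α)) (hα : 0 ≤ α) (hσ : 0 < σa ^ 2 + σs ^ 2) {f : ℝ → ℝ}
    (hf : LipschitzWith 1 f) :
    |∫ q, f (scaledTotal α σa σs q) ∂π.toMeasure - ∫ s, f s ∂(expMeasure 1)| ≤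
      2 * (N : ℝ) ^ (-α) / (σa ^ 2 + σs ^ 2) * (N * M +
        8 * N ^ 2 * M ^ 2 / δ * (α * Real.log N + 2 * N * M) + 4 * (N + 1) * M
          + 3 * N * (N : ℝ) ^ (-α)) := by
  have hN : (0 : ℝ) < N := natCast_pos_of_neZero
  have hM1 : 1 ≤ M := h.one_le_smax.trans ((le_max_right _ _).trans hM)
  have hM0 : (0 : ℝ) < M := by linarith
  have hε : 0 ≤ 1 - (N : ℝ) ^ (-α) := hδ0.le.trans hδ
  have hm : 0 ≤ N * (1 - (N : ℝ) ^ (-α)) := mul_nonneg hN.le hε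
  obtain ⟨R, hRint, hRle, hRI⟩ := h.integral_unused_mul_total_le hst hM hδ0 hδ hα
  have hUint := h.integrable_unused hst hε
  have hUI := h.integral_unused hst hε
  have hDint := h.integrable_centeredInput
  have hDI := h.integral_centeredInput
  have hD2int := h.integrable_centeredInput_sq hM hM1 hm
  have hD2I := h.integral_centeredInput_sq
  have hTint := h.integrable_total hst hε
  have hT2int := h.integrable_total_sq hst hε
  have hscaled : ∀ q, scaledTotal α σa σs q
      = 2 * (N : ℝ) ^ (-α) / (σa ^ 2 + σs ^ 2) * total q := fun q => rfl
  have hε0 : 0 < (N : ℝ) ^ (-α) := Real.rpow_pos_of_pos hN _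
  obtain ⟨ε, hεdef⟩ : ∃ ε, ε = (N : ℝ) ^ (-α) := ⟨_, rfl⟩
  obtain ⟨c, hc⟩ : ∃ c, c = 2 * ε / (σa ^ 2 + σs ^ 2) := ⟨_, rfl⟩
  -- Here `b` is the downward drift of the scaled total. The scale `c` is the one for which half the
  -- variance of the scaled centered input equals `b` (`hbσ`), so that the second-order Stein term
  -- has mean zero.
  obtain ⟨b, hb⟩ : ∃ b, b = c * (N * ε) := ⟨_, rfl⟩
  have hpart := unused_eq_sub_centeredInput (N := N) α
  simp only [← hεdef] at hRI hUI hscaled hε0 hpart ⊢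
  simp only [← hc] at hscaled ⊢
  have hc0 : 0 < c := by rw [hc]; positivity
  have hb0 : 0 < b := by rw [hb]; positivity
  have hbσ : c ^ 2 / 2 * (N * (σa ^ 2 + σs ^ 2)) = b := by rw [hb, hc]; field_simp
  simp only [hscaled]
  set m : ℝ := ∫ s, f s ∂(expMeasure 1) with hmdef
  set P := (dispatchLaw π).prod S.noise with hP
  have hXint : Integrable (fun q => c * total q) π.toMeasure := hTint.const_mul c
  have hX'int : Integrable (fun q => c * total q - b) π.toMeasure := hXint.sub (integrable_const _)
  have hpInt : Integrable (fun q => expSteinPrimitive f (c * total q)) π.toMeasure := by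
    refine Integrable.mono' (hT2int.const_mul (c ^ 2)) Measurable.of_discrete.aestronglyMeasurable
      (ae_of_all _ fun q => ?_)
    refine (abs_expSteinPrimitive_le hf _).trans (le_of_eq (by ring))
  have hgInt := (lipschitzWith_expSteinSolution hf).integrable_of_integrable_id hX'int
  have hg'Int := (lipschitzWith_expSteinDeriv hf).integrable_of_integrable_id hX'int
  have hfInt := hf.integrable_of_integrable_id hXint
  have j1 : Integrable (fun z => expSteinPrimitive f (c * total (stepMap z))) P :=
    integrable_comp_stepMap hst hpInt
  have j2 : Integrable (fun z => expSteinPrimitive f (c * total z.1.1)) P :=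
    integrable_comp_current S hpInt
  have j3 : Integrable (fun z : ((Fin N → ℕ) × Fin N) × (ℕ × (Fin N → ℕ)) =>
      expSteinSolution f (c * total z.1.1 - b) * (c * centeredInput α z.2)) P :=
    (integrable_comp_dispatch hgInt).mul_prod (hDint.const_mul c)
  have j4 : Integrable (fun z : ((Fin N → ℕ) × Fin N) × (ℕ × (Fin N → ℕ)) =>
      expSteinDeriv f (c * total z.1.1 - b) * (c ^ 2 / 2 * centeredInput α z.2 ^ 2 - b)) P :=
    (integrable_comp_dispatch hg'Int).mul_prod ((hD2int.const_mul _).sub (integrable_const b))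
  have j5 : Integrable (fun z => b * (f (c * total z.1.1) - m)) P :=
    ((integrable_comp_current S hfInt).sub (integrable_const m)).const_mul b
  have j12 : Integrable (fun z => expSteinPrimitive f (c * total (stepMap z))
      - expSteinPrimitive f (c * total z.1.1)) P := j1.sub j2
  have j123 : Integrable (fun z => expSteinPrimitive f (c * total (stepMap z))
      - expSteinPrimitive f (c * total z.1.1)
      - expSteinSolution f (c * total z.1.1 - b) * (c * centeredInput α z.2)) P := j12.sub j3
  have j1234 : Integrable (fun z => expSteinPrimitive f (c * total (stepMap z))
      - expSteinPrimitive f (c * total z.1.1)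
      - expSteinSolution f (c * total z.1.1 - b) * (c * centeredInput α z.2)
      - expSteinDeriv f (c * total z.1.1 - b) * (c ^ 2 / 2 * centeredInput α z.2 ^ 2 - b)) P :=
    j123.sub j4
  -- In the mean of `G` the two primitives cancel by stationarity, and the two products vanish
  -- because state and noise are independent. Only `-b` times the quantity to be bounded survives.
  set G : ((Fin N → ℕ) × Fin N) × (ℕ × (Fin N → ℕ)) → ℝ := fun z =>
    expSteinPrimitive f (c * total (stepMap z)) - expSteinPrimitive f (c * total z.1.1)
      - expSteinSolution f (c * total z.1.1 - b) * (c * centeredInput α z.2)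
      - expSteinDeriv f (c * total z.1.1 - b) * (c ^ 2 / 2 * centeredInput α z.2 ^ 2 - b)
      - b * (f (c * total z.1.1) - m) with hG
  have hGI : ∫ z, G z ∂P = -(b * (∫ q, f (c * total q) ∂π.toMeasure - m)) := by
    have k3 : ∫ z, expSteinSolution f (c * total z.1.1 - b) * (c * centeredInput α z.2) ∂P = 0 := by
      rw [hP, integral_prod_mul (fun y : (Fin N → ℕ) × Fin N => expSteinSolution f (c * total y.1 - b))
        (fun ξ => c * centeredInput α ξ), integral_const_mul, hDI]
      simp
    have k4 : ∫ z, expSteinDeriv f (c * total z.1.1 - b)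
        * (c ^ 2 / 2 * centeredInput α z.2 ^ 2 - b) ∂P = 0 := by
      rw [hP, integral_prod_mul (fun y : (Fin N → ℕ) × Fin N => expSteinDeriv f (c * total y.1 - b))
        (fun ξ => c ^ 2 / 2 * centeredInput α ξ ^ 2 - b),
        integral_sub (hD2int.const_mul _) (integrable_const b), integral_const_mul, hD2I, hbσ]
      simp
    rw [hG, integral_sub j1234 j5, integral_sub j123 j4, integral_sub j12 j3, integral_sub j1 j2,
      k3, k4, integral_const_mul, hP,
      integral_comp_stepMap hst (fun q => expSteinPrimitive f (c * total q)),
      integral_comp_current S (fun q => expSteinPrimitive f (c * total q)),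
      integral_sub (integrable_comp_current S hfInt) (integrable_const m),
      integral_comp_current S (fun q => f (c * total q))]
    simp
  set B : ℝ := (N + 1) * M with hB
  have jR : Integrable (fun z => c ^ 2 * (N * M) * unused z + c ^ 2 * R z
      + 2 * c ^ 3 * B * centeredInput α z.2 ^ 2 + 3 * b ^ 2) P :=
    (((hUint.const_mul _).add (hRint.const_mul _)).add ((hD2int.comp_snd _).const_mul _)).add
      (integrable_const _)
  have hGle : ∀ᵐ z ∂P, |G z| ≤ c ^ 2 * (N * M) * unused z + c ^ 2 * R z
      + 2 * c ^ 3 * B * centeredInput α z.2 ^ 2 + 3 * b ^ 2 := by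
    filter_upwards [hRle, Measure.quasiMeasurePreserving_snd.ae (h.ae_noise hM),
      Measure.quasiMeasurePreserving_snd.ae (h.abs_centeredInput_le hM hM1 hm)]
      with z hz1 hz2 hz3
    have hU0 := unused_nonneg z
    have hUle := unused_le hM0.le hz2.2
    have hT0 : 0 ≤ total (stepMap z) := Finset.sum_nonneg fun j _ => Nat.cast_nonneg _
    have key := abs_expSteinPrimitive_increment_le hf (c * total z.1.1) b
      (c * centeredInput α z.2) (c * unused z)
    have e1 : c * total z.1.1 - b + c * centeredInput α z.2 + c * unused z
        = c * total (stepMap z) := by rw [hpart z, hb]; ring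
    rw [e1, abs_of_nonneg (mul_nonneg hc0.le hU0), abs_of_nonneg (mul_nonneg hc0.le hT0), abs_mul,
      abs_of_pos hc0] at key
    have e2 : G z = expSteinPrimitive f (c * total (stepMap z))
        - expSteinPrimitive f (c * total z.1.1)
        - c * centeredInput α z.2 * expSteinSolution f (c * total z.1.1 - b)
        - ((c * centeredInput α z.2) ^ 2 / 2 - b) * expSteinDeriv f (c * total z.1.1 - b)
        - b * (f (c * total z.1.1) - m) := by simp only [hG]; ring
    rw [e2]
    refine key.trans ?_
    have r1 : (c * unused z) ^ 2 ≤ c ^ 2 * (N * M) * unused z := by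
      calc (c * unused z) ^ 2 = c ^ 2 * unused z * unused z := by ring
        _ ≤ c ^ 2 * unused z * (N * M) := by gcongr
        _ = _ := by ring
    have r2 : c * unused z * (c * total (stepMap z)) ≤ c ^ 2 * R z := by
      calc c * unused z * (c * total (stepMap z)) = c ^ 2 * (unused z * total (stepMap z)) := by ring
        _ ≤ _ := by gcongr
    have r3 : 2 * (c * |centeredInput α z.2|) ^ 3 ≤ 2 * c ^ 3 * B * centeredInput α z.2 ^ 2 := by
      calc 2 * (c * |centeredInput α z.2|) ^ 3
          = 2 * c ^ 3 * |centeredInput α z.2| * |centeredInput α z.2| ^ 2 := by ring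
        _ ≤ 2 * c ^ 3 * B * |centeredInput α z.2| ^ 2 := by gcongr
        _ = _ := by rw [sq_abs]
    linarith
  have hfinal : |∫ z, G z ∂P| ≤ c ^ 2 * (N * M) * (N * ε)
      + c ^ 2 * (8 * N ^ 2 * M ^ 2 / δ * (N * ε) * (α * Real.log N + 2 * N * M))
      + 2 * c ^ 3 * B * (N * (σa ^ 2 + σs ^ 2)) + 3 * b ^ 2 := by
    have l1 : Integrable (fun z => c ^ 2 * (N * M) * unused z) P := hUint.const_mul _
    have l2 : Integrable (fun z => c ^ 2 * R z) P := hRint.const_mul _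
    have l3 : Integrable (fun z : ((Fin N → ℕ) × Fin N) × (ℕ × (Fin N → ℕ)) =>
      2 * c ^ 3 * B * centeredInput α z.2 ^ 2) P := (hD2int.comp_snd _).const_mul _
    have l12 : Integrable (fun z => c ^ 2 * (N * M) * unused z + c ^ 2 * R z) P := l1.add l2
    have l123 : Integrable (fun z => c ^ 2 * (N * M) * unused z + c ^ 2 * R z
      + 2 * c ^ 3 * B * centeredInput α z.2 ^ 2) P := l12.add l3
    have k := norm_integral_le_of_norm_le (f := G) jR hGle
    rw [Real.norm_eq_abs] at k
    rw [integral_add l123 (integrable_const _), integral_add l12 l3, integral_add l1 l2,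
      integral_const_mul, integral_const_mul, integral_const_mul, hUI,
      integral_fun_snd (fun ξ : ℕ × (Fin N → ℕ) => centeredInput α ξ ^ 2), hD2I] at k
    have hR2 := mul_le_mul_of_nonneg_left hRI (sq_nonneg c)
    simp at k
    linarith
  -- Every error term contains the factor `b`, since `c² N ε = c b` and the cubic term equals `4 c B
  -- b`; cancelling it leaves a bound of order `c`.
  rw [hGI, abs_neg, abs_mul, abs_of_pos hb0] at hfinal
  refine le_of_mul_le_mul_left (hfinal.trans (le_of_eq ?_)) hb0
  have e3 : 2 * c ^ 3 * B * (N * (σa ^ 2 + σs ^ 2))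
      = 4 * c * B * (c ^ 2 / 2 * (N * (σa ^ 2 + σs ^ 2))) := by ring
  rw [e3, hbσ, hB]
  simp only [hb]
  ring

end LoadBalancingSystem

namespace LoadBalancingSystem

theorem measurable_scaledTotal {N : ℕ} (α σa σs : ℝ) :
    Measurable (scaledTotal (N := N) α σa σs) := Measurable.of_discrete

/-- Since arrivals are bounded and the load is at least `δ`, powers of `N` are absorbed by `C`. -/
theorem approximation_error_le_wassersteinBound {N : ℕ} {α σa σs smax M δ : ℝ} (hN2 : 2 ≤ N)
    (hα : 1 < α) (hσ : 0 < σa ^ 2 + σs ^ 2) (hδ0 : 0 < δ) (hδ1 : δ < 1) (hM1 : 1 ≤ M)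
    (hNR : (N : ℝ) ≤ M / δ) (hsmax : 1 ≤ smax) :
    2 * (N : ℝ) ^ (-α) / (σa ^ 2 + σs ^ 2) * (N * M +
        8 * N ^ 2 * M ^ 2 / δ * (α * Real.log N + 2 * N * M) + 4 * (N + 1) * M
          + 3 * N * (N : ℝ) ^ (-α)) ≤
      wassersteinBound N α σa σs smax (100 * (M / δ) ^ 7) := by
  have hNr : (2 : ℝ) ≤ N := by exact_mod_cast hN2
  have hN : (0 : ℝ) < N := by linarith
  have hε0 : 0 < (N : ℝ) ^ (-α) := Real.rpow_pos_of_pos hN _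
  have hε1 : (N : ℝ) ^ (-α) ≤ 1 := Real.rpow_le_one_of_one_le_of_nonpos (by linarith) (by linarith)
  set R : ℝ := M / δ with hR
  have hMR : M ≤ R := by rw [hR, le_div_iff₀ hδ0]; nlinarith
  have hR1 : 1 ≤ R := hM1.trans hMR
  have hδR : 1 / δ ≤ R := by rw [hR]; gcongr
  have hlog0 : 0 < Real.log N := Real.log_pos (by linarith)
  have hlogR : Real.log N ≤ R := (Real.log_le_self hN.le).trans hNR
  have hM0 : 0 < M := by linarith
  have hR0 : 0 < R := by linarith
  have hα0 : 0 < α := by linarith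
  have hp : ∀ k, k ≤ 7 → R ^ k ≤ R ^ 7 := fun k hk => pow_le_pow_right₀ hR1 hk
  have hα7 : R ^ 7 ≤ α * R ^ 7 := le_mul_of_one_le_left (by positivity) hα.le
  have s1 : N * M ≤ α * R ^ 7 := by
    calc N * M ≤ R * R := by gcongr
      _ = R ^ 2 := by ring
      _ ≤ _ := (hp 2 (by norm_num)).trans hα7
  have s2 : 8 * N ^ 2 * M ^ 2 / δ * (α * Real.log N + 2 * N * M) ≤ 24 * (α * R ^ 7) := by
    have t1 : 8 * N ^ 2 * M ^ 2 / δ ≤ 8 * R ^ 5 := by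
      calc 8 * N ^ 2 * M ^ 2 / δ = 8 * N ^ 2 * M ^ 2 * (1 / δ) := by ring
        _ ≤ 8 * R ^ 2 * R ^ 2 * R := by gcongr
        _ = _ := by ring
    have t2 : α * Real.log N + 2 * N * M ≤ 3 * (α * R ^ 2) := by
      have u1 : α * Real.log N ≤ α * R ^ 2 := by
        gcongr; exact hlogR.trans (by nlinarith)
      have u2 : N * M ≤ R * R := by gcongr
      have u3 : R ^ 2 ≤ α * R ^ 2 := le_mul_of_one_le_left (by positivity) hα.le
      nlinarith
    calc 8 * N ^ 2 * M ^ 2 / δ * (α * Real.log N + 2 * N * M)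
        ≤ 8 * R ^ 5 * (3 * (α * R ^ 2)) := by gcongr
      _ = _ := by ring
  have s3 : 4 * (N + 1) * M ≤ 8 * (α * R ^ 7) := by
    calc 4 * (N + 1) * M ≤ 4 * (R + R) * R := by gcongr
      _ = 8 * R ^ 2 := by ring
      _ ≤ _ := by gcongr; exact (hp 2 (by norm_num)).trans hα7
  have s4 : 3 * N * (N : ℝ) ^ (-α) ≤ 3 * (α * R ^ 7) := by
    calc 3 * N * (N : ℝ) ^ (-α) ≤ 3 * R * 1 := by gcongr
      _ = 3 * R ^ 1 := by ring
      _ ≤ _ := by gcongr; exact (hp 1 (by norm_num)).trans hα7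
  -- The ceiling is at least both `α - 1` and `1`, hence at least their mean.
  have hceil : α / 2 ≤ (⌈α - 1⌉ : ℝ) := by
    have c1 : α - 1 ≤ (⌈α - 1⌉ : ℝ) := Int.le_ceil _
    have c2 : (1 : ℝ) ≤ (⌈α - 1⌉ : ℝ) := by
      exact_mod_cast Int.one_le_ceil_iff.2 (sub_pos.2 hα)
    linarith
  have hceillog : (1 : ℝ) ≤ (⌈Real.log N⌉ : ℝ) := by
    exact_mod_cast Int.one_le_ceil_iff.2 hlog0
  have hexp : 1 ≤ Real.exp (1 / (2 * Real.exp 1) + 1) := Real.one_le_exp (by positivity)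
  have hpow : (N : ℝ) ^ (-α) ≤ (N : ℝ) ^ (2 - α) :=
    Real.rpow_le_rpow_of_exponent_le (by linarith) (by linarith)
  -- The logarithmic term of the target alone dominates the whole error; its other two terms are
  -- only used to be nonnegative.
  have hmain : 100 * R ^ 7 * α * (N : ℝ) ^ (-α) ≤
      2 * (100 * R ^ 7 * smax * Real.exp (1 / (2 * Real.exp 1) + 1)) * (⌈α - 1⌉ : ℝ) *
        (N : ℝ) ^ (2 - α) * (⌈Real.log N⌉ : ℝ) := by
    calc 100 * R ^ 7 * α * (N : ℝ) ^ (-α)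
        = 2 * (100 * R ^ 7 * 1 * 1) * (α / 2) * (N : ℝ) ^ (-α) * 1 := by ring
      _ ≤ _ := by gcongr
  have h1 : 0 ≤ 5 * smax * (N : ℝ) ^ (1 - α) := by positivity
  have h2 : 0 ≤ (N : ℝ) ^ (1 - 2 * α) := by positivity
  rw [wassersteinBound, div_mul_eq_mul_div, one_div_mul_eq_div]
  gcongr
  calc _ ≤ 2 * (N : ℝ) ^ (-α) * (50 * (α * R ^ 7)) := by
        gcongr
        have : 0 < α * R ^ 7 := by positivity
        linarith
    _ = 100 * R ^ 7 * α * (N : ℝ) ^ (-α) := by ring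
    _ ≤ _ := by linarith

end LoadBalancingSystem

end

/-! ### Choice of the constant and conclusion -/

theorem theorem3 :
    (∀ M δ : ℝ, 0 < δ → δ < 1 → ∃ C : ℝ,
      ∀ (N : ℕ) [NeZero N] (α σa σs amax smax : ℝ) (S : LoadBalancingSystem N)
        (π : PMF (Fin N → ℕ)),
        1 < α → 0 < σa ^ 2 + σs ^ 2 → max amax smax ≤ M → δ ≤ 1 - (N : ℝ) ^ (-α) →
        S.IsParametrized α σa σs amax smax → S.IsSteadyState π →
          LoadBalancingSystem.StateSpaceCollapse π C ∧
          Integrable (LoadBalancingSystem.scaledTotal α σa σs) π.toMeasure ∧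
          wassersteinDist
              (π.toMeasure.map (LoadBalancingSystem.scaledTotal α σa σs)) (expMeasure 1) ≤
            ENNReal.ofReal (LoadBalancingSystem.wassersteinBound N α σa σs smax C)) ∧
    (∀ α σa σs smax C : ℝ, 2 < α →
      Tendsto (fun N : ℕ => LoadBalancingSystem.wassersteinBound N α σa σs smax C)
        atTop (𝓝 0)) := by
  refine ⟨fun M δ hδ0 hδ1 => ⟨100 * (M / δ) ^ 7, ?_⟩, LoadBalancingSystem.tendsto_wassersteinBound⟩
  intro N _ α σa σs amax smax S π hα hσ hM hδ h hπ
  have hst := hπ.bind_jsqStep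
  have hN0 : (0 : ℝ) < N := by exact_mod_cast NeZero.pos N
  -- For `N = 1` the load `1 - N^{-α}` is zero, below `δ`. From `N = 2` on, `⌈log N⌉ ≥ 1`, without
  -- which the last term of the bound would vanish.
  have hN2 : 2 ≤ N := by
    by_contra hlt
    have hN1 : N = 1 := by have := NeZero.pos N; omega
    subst hN1
    simp at hδ
    linarith
  have hM1 : 1 ≤ M := h.one_le_smax.trans ((le_max_right _ _).trans hM)
  have hNR : (N : ℝ) ≤ M / δ := by
    rw [le_div_iff₀ hδ0]
    exact (mul_le_mul_of_nonneg_left hδ hN0.le).trans (h.arrival_mean_le hM)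
  have hε : 0 ≤ 1 - (N : ℝ) ^ (-α) := hδ0.le.trans hδ
  refine ⟨h.stateSpaceCollapse hst hM hδ0 hδ ?_, ?_, ?_⟩
  · have hMR : M ≤ M / δ := by rw [le_div_iff₀ hδ0]; nlinarith
    have hδR : 1 / δ ≤ M / δ := by gcongr
    have hR1 : 1 ≤ M / δ := hM1.trans hMR
    calc 32 * N ^ 2 * M ^ 2 / δ = 32 * N ^ 2 * M ^ 2 * (1 / δ) := by ring
      _ ≤ 32 * (M / δ) ^ 2 * (M / δ) ^ 2 * (M / δ) := by gcongr
      _ = 32 * (M / δ) ^ 5 := by ring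
      _ ≤ 100 * (M / δ) ^ 7 := by
          gcongr
          · norm_num
          · norm_num
  · exact (h.integrable_total hst hε).const_mul _
  · refine iSup₂_le fun f hf => ENNReal.ofReal_le_ofReal ?_
    rw [integral_map (LoadBalancingSystem.measurable_scaledTotal α σa σs).aemeasurable
      hf.continuous.aestronglyMeasurable]
    exact (h.abs_integral_scaledTotal_sub_le hst hM hδ0 hδ (by linarith) hσ hf).trans
      (LoadBalancingSystem.approximation_error_le_wassersteinBound hN2 hα hσ hδ0 hδ1 hM1 hNR
        h.one_le_smax)
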